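/- For $n \ge 2$ let $f : [0,1]^2 \to [0,1]$ be symmetric and let $\mathbb{P}_\xi$ be a probability distribution on $[0,1]$. Let $\xi_1,\dots,\xi_n$ be i.i.d. with law $\mathbb{P}_\xi$, put $M_{ij} = f(\xi_i,\xi_j)$ and, conditionally on $(\xi_1,\dots,\xi_n)$, let $A_{ij} = A_{ji} \sim \mathrm{Bern}(M_{ij})$ be independent for $1 \le i < j \le n$, with $A_{ii} = 0$. For an estimator $\widehat f$, with $\widehat M_{ij} = \widehat f(\xi_i,\xi_j)$ a function of $A$, let $$\ell(\widehat f, f) = \binom{n}{2}^{-1} \sum_{1 \le i < j \le n} (\widehat M_{ij} - M_{ij})^2 .$$ For $\gamma > 0$ and $L > 0$ let $\mathcal{D} = \{(x,y) \in [0,1]^2 : x \ge y\}$, $\nabla_{jk} f = \partial^{j+k} f / (\partial x)^j (\partial y)^k$ and $$\|f\|_{\mathcal{H}_\gamma} = \max_{j+k \le \lfloor\gamma\rfloor} \sup_{(x,y) \in \mathcal{D}} |\nabla_{jk} f(x,y)| + \max_{j+k = \lfloor\gamma\rfloor} \sup_{(x,y) \ne (x',y') \in \mathcal{D}} \frac{|\nabla_{jk}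 f(x,y) - \nabla_{jk} f(x',y')|}{(|x-x'| + |y-y'|)^{\gamma - \lfloor\gamma\rfloor}} ,$$ and let $\mathcal{F}_\gamma(L)$ be the class of symmetric $f : [0,1]^2 \to [0,1]$ that are $\lfloor\gamma\rfloor$ times continuously differentiable on $\mathcal{D}$ with $\|f\|_{\mathcal{H}_\gamma} \le L$. Theorem. For every $L > 0$ there is a constant $c > 0$ depending only on $L$ such that for all $\gamma \ge 3/2$ and all integers $D \ge 1$ and $n \ge 2$, $$\inf_{\widehat f} \; \sup_{f \in \mathcal{F}_\gamma(L)} \; \sup_{\mathbb{P}_\xi} \; \mathbb{E}\,\ell(\widehat f, f) \;\ge\; \frac{c}{D^4}\, n^{-\frac{2\gamma}{2\gamma+1}} ,$$ where the infimum is over all estimators such that, for all $1 \le i < j \le n$, $\widehat M_{ij} = \widehat f(\xi_i, \xi_j)$ is a real polynomial of degree at most $D$ in the entries of $A$ (with coefficients not depending on $\xi$), and $\mathbb{P}_\xi$ ranges over all probability distributions on $[0,1]$. -/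

import Mathlib

open Set MeasureTheory
open scoped ENNReal unitInterval

noncomputable section

namespace Graphon

/-- The closed triangle `{(x, y) ∈ [0,1] × [0,1] : x ≥ y}`. -/
def triangle : Set (ℝ × ℝ) :=
  {z | z.1 ∈ Icc (0 : ℝ) 1 ∧ z.2 ∈ Icc (0 : ℝ) 1 ∧ z.2 ≤ z.1}

/-- The partial derivative `∂^(j+k) f / (∂x)^j (∂y)^k` at a point `z` of the triangle. It is the
iterated derivative within the triangle, applied `j` times to `(1, 0)` and `k` times to `(0, 1)`,
so that it is the one-sided (limiting) derivative at boundary points; `pderiv 0 0 f = f`. -/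
def pderiv (j k : ℕ) (f : ℝ × ℝ → ℝ) (z : ℝ × ℝ) : ℝ :=
  iteratedFDerivWithin ℝ (j + k) f triangle z
    (fun i : Fin (j + k) => if (i : ℕ) < j then ((1 : ℝ), (0 : ℝ)) else ((0 : ℝ), (1 : ℝ)))

/-- The Hölder norm of smoothness `γ` on the triangle, with values in `[0, ∞]`. It is meaningful
for functions that are `⌊γ⌋` times continuously differentiable on the triangle. -/
def holderNorm (γ : ℝ) (f : ℝ × ℝ → ℝ) : ℝ≥0∞ :=
  (⨆ (j : ℕ) (k : ℕ) (_ : j + k ≤ ⌊γ⌋₊) (z ∈ triangle), ENNReal.ofReal |pderiv j k f z|) +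
  ⨆ (j : ℕ) (k : ℕ) (_ : j + k = ⌊γ⌋₊) (z ∈ triangle) (w ∈ triangle) (_ : z ≠ w),
    ENNReal.ofReal
      (|pderiv j k f z - pderiv j k f w| / (|z.1 - w.1| + |z.2 - w.2|) ^ (γ - (⌊γ⌋₊ : ℝ)))

/-- The Hölder class: symmetric functions on the unit square whose restriction to the triangle is
`⌊γ⌋` times continuously differentiable with Hölder norm at most `L`. -/
def holderClass (γ L : ℝ) : Set (ℝ × ℝ → ℝ) :=
  {f | ContDiffOn ℝ (⌊γ⌋₊ : ℕ) f triangle ∧ holderNorm γ f ≤ ENNReal.ofReal L ∧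
    ∀ x ∈ Icc (0 : ℝ) 1, ∀ y ∈ Icc (0 : ℝ) 1, f (x, y) = f (y, x)}

/-- The smooth graphons: the members of the Hölder class with values in `[0, 1]` on the unit
square. -/
def smoothGraphons (γ L : ℝ) : Set (ℝ × ℝ → ℝ) :=
  {f | f ∈ holderClass γ L ∧
    ∀ x ∈ Icc (0 : ℝ) 1, ∀ y ∈ Icc (0 : ℝ) 1, f (x, y) ∈ Icc (0 : ℝ) 1}

/-- The pairs `i < j` of nodes. -/
abbrev Pairs (n : ℕ) : Type := {p : Fin n × Fin n // p.1 < p.2}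

/-- The adjacency matrix of the undirected graph on `n` nodes whose edges are the pairs `i < j`
with `a (i, j) = true`: symmetric, with entries in `{0, 1}` and zero diagonal. -/
def adjacency {n : ℕ} (a : Pairs n → Bool) : Matrix (Fin n) (Fin n) ℝ :=
  fun i j =>
    if h : i < j then (if a ⟨(i, j), h⟩ then 1 else 0)
    else if h : j < i then (if a ⟨(j, i), h⟩ then 1 else 0)
    else 0

/-- The edge probabilities `M i j = f (ξ i, ξ j)`, `i < j`. -/
def edgeProb {n : ℕ} (f : ℝ × ℝ → ℝ) (ξ : Fin n → I) (p : Pairs n) : ℝ :=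
  f ((ξ p.1.1 : ℝ), (ξ p.1.2 : ℝ))

/-- The conditional probability of the graph `a` given the latent variables `ξ`: independent edges,
the edge `i < j` being present with probability `f (ξ i, ξ j)`. -/
def graphProb {n : ℕ} (f : ℝ × ℝ → ℝ) (ξ : Fin n → I) (a : Pairs n → Bool) : ℝ :=
  ∏ p : Pairs n, if a p then edgeProb f ξ p else 1 - edgeProb f ξ p

/-- An estimator all of whose entries `Mhat i j`, `i < j`, are polynomials in the entries of the
adjacency matrix. -/
abbrev PolyEstimator (n : ℕ) : Type := Pairs n → MvPolynomial (Fin n × Fin n) ℝ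

/-- The empirical loss `(n choose 2)⁻¹ ∑_{i<j} (Mhat i j (A) - f (ξ i, ξ j))²`. -/
def loss {n : ℕ} (Mhat : PolyEstimator n) (f : ℝ × ℝ → ℝ) (ξ : Fin n → I)
    (a : Pairs n → Bool) : ℝ :=
  (1 / (n.choose 2 : ℝ)) * ∑ p : Pairs n,
    (MvPolynomial.eval (fun q : Fin n × Fin n => adjacency a q.1 q.2) (Mhat p)
      - edgeProb f ξ p) ^ 2

/-- The expected loss, when the `ξ i` are i.i.d. with law `P` and, given `ξ`, the graph is drawn
with probabilities `graphProb f ξ`. -/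
def risk {n : ℕ} (Mhat : PolyEstimator n) (f : ℝ × ℝ → ℝ) (P : ProbabilityMeasure I) : ℝ≥0∞ :=
  ∫⁻ ξ, ∑ a : Pairs n → Bool, ENNReal.ofReal (graphProb f ξ a * loss Mhat f ξ a)
    ∂(Measure.pi fun _ : Fin n => (P : Measure I))

/-- The minimax risk over smooth graphons and all latent laws on `[0, 1]`, of the estimators whose
entries are polynomials of degree at most `D` in the adjacency matrix. -/
def lowDegreeMinimaxRisk (γ L : ℝ) (n D : ℕ) : ℝ≥0∞ :=
  ⨅ (Mhat : PolyEstimator n) (_ : ∀ p, (Mhat p).totalDegree ≤ D),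
    ⨆ f ∈ smoothGraphons γ L, ⨆ P : ProbabilityMeasure I, risk Mhat f P

end Graphon

end

noncomputable section

namespace Graphon

open Finset
open scoped BigOperators

/-! One graphon and one latent law suffice for given `γ`, `n`, `D`; what makes estimation hard is
that the latent positions are hidden. Take `K = 2 * 4 ^ d` labels, uniform on `F₂ × F₂^d × F₂^d`,
place them at grid points `a / K`, and let `f` equal `p ± lam` at pairs of grid points, the signs
being those of `table`. Fejér kernels interpolate this table with derivatives of order `j ≥ 1` at
most `lam (4πK)^j`, so `f` lies in the Hölder class once `lam (4πK)^γ` is small, with no constant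
depending on `γ`. Polynomials of degree `D` cannot improve on the constant `p` by more than a factor
when `lam²` is a small multiple of `K / (n D⁴)`. The two requirements meet at `K ≈ n^(1/(2γ+1))`,
which is the rate.

The low degree bound for an edge `e₀` with sign `s` is a duality argument (`le_expect_sq_error`).
Suppose `h` satisfies `E[g (h - lam s)] = 0` for every low degree `g`, and `E h² ≤ lam²/2`.
Completing the square gives `E (g - p - lam s)² ≥ lam² - E h² ≥ lam²/2`. Such an `h` is a
combination of products of standardised residuals, orthogonal given the labels. The orthogonality
conditions are solved by joint cumulants of the signs (`sum_certCoeff`), and `E h²` reduces to a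
weighted sum of squared cumulants (`sum_certCoeff_sq_le`).

A cumulant of `e₀` and `β` vanishes unless `insert e₀ β` is connected with all degrees even
(`cumulant_eq_zero_of_splits`, `cumulant_eq_zero_of_odd`). Its size is governed by the probability
that, at each vertex, the third label components of the neighbours sum to zero (`abs_moment_le`,
`abs_cumulant_le`). For a connected even graph with `V` vertices and `E` edges an exploration bounds
this by `(2^d)^(2 + 2E - 3V)` (`kerProb_le`). When `(4^d)³ ≤ n` the square of this pays for the
`n^(V-2)` choices of vertices (`cumulant_sq_mul_le`), and `D⁴` pays for the combinatorial factors
(`sum_cumulant_sq_le`). -/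

variable {n d : ℕ}

/-! ### Labels, the sign table, and edges of the complete graph. -/

/-- The sign character of `ZMod 2`. -/
def sgn (x : ZMod 2) : ℝ := if x = 0 then 1 else -1

lemma sgn_zero : sgn 0 = 1 := by simp [sgn]

lemma sgn_one : sgn 1 = -1 := by simp [sgn]

lemma sgn_add (x y : ZMod 2) : sgn (x + y) = sgn x * sgn y := by
  have h2 : ∀ z : ZMod 2, z = 0 ∨ z = 1 := by decide
  have h11 : (1 : ZMod 2) + 1 = 0 := by decide
  rcases h2 x with rfl | rfl <;> rcases h2 y with rfl | rfl <;> simp [sgn, h11]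

lemma sgn_mul_self (x : ZMod 2) : sgn x * sgn x = 1 := by
  unfold sgn; split_ifs <;> simp

lemma abs_sgn (x : ZMod 2) : |sgn x| = 1 := by
  unfold sgn; split_ifs <;> simp

lemma sgn_sum {ι : Type*} (s : Finset ι) (f : ι → ZMod 2) :
    sgn (∑ i ∈ s, f i) = ∏ i ∈ s, sgn (f i) := by
  classical
  induction s using Finset.induction_on with
  | empty => simp [sgn_zero]
  | insert a s ha ih => rw [sum_insert ha, prod_insert ha, sgn_add, ih]

lemma sgn_eq_neg_one {x : ZMod 2} (hx : x ≠ 0) : sgn x = -1 := by simp [sgn, hx]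

/-- The latent labels: a sign and two vectors over the field with two elements. -/
abbrev Label (d : ℕ) : Type := ZMod 2 × (Fin d → ZMod 2) × (Fin d → ZMod 2)

/-- The symplectic-type form defining the block signs. -/
def form (x y : Label d) : ZMod 2 := x.1 + y.1 + (x.2.1 ⬝ᵥ y.2.2 + y.2.1 ⬝ᵥ x.2.2)

lemma form_comm (x y : Label d) : form x y = form y x := by
  unfold form; ring

/-- The variation of `form` in its first argument. -/
def formLin (t y : Label d) : ZMod 2 := t.1 + (t.2.1 ⬝ᵥ y.2.2 + y.2.1 ⬝ᵥ t.2.2)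

lemma form_add_left (x t y : Label d) : form (x + t) y = form x y + formLin t y := by
  simp only [form, formLin, Prod.fst_add, Prod.snd_add, add_dotProduct, dotProduct_add]; ring

/-- The symmetric table of block signs. -/
def table (x y : Label d) : ℝ := sgn (form x y)

lemma table_comm (x y : Label d) : table x y = table y x := by rw [table, form_comm, table]

lemma abs_table (x y : Label d) : |table x y| = 1 := abs_sgn _

lemma table_mul_self (x y : Label d) : table x y * table x y = 1 := sgn_mul_self _

/-- The block sign of the edge `e`. -/
def edgeSign (l : Fin n → Label d) (e : Pairs n) : ℝ := table (l e.1.1) (l e.1.2)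

/-- The two ends of an edge. -/
def ends (e : Pairs n) : Finset (Fin n) := {e.1.1, e.1.2}

/-- The end of `e` other than `i`. -/
def other (e : Pairs n) (i : Fin n) : Fin n := if e.1.1 = i then e.1.2 else e.1.1

lemma mem_ends {e : Pairs n} {i : Fin n} : i ∈ ends e ↔ i = e.1.1 ∨ i = e.1.2 := by
  simp [ends]

lemma ends_nonempty (e : Pairs n) : (ends e).Nonempty := ⟨e.1.1, by simp [ends]⟩

lemma card_ends (e : Pairs n) : (ends e).card = 2 := card_pair (ne_of_lt e.2)

lemma other_mem_ends (e : Pairs n) (i : Fin n) : other e i ∈ ends e := by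
  unfold other ends; split_ifs <;> simp

lemma other_ne {e : Pairs n} {i : Fin n} (hi : i ∈ ends e) : other e i ≠ i := by
  have := ne_of_lt e.2
  rcases mem_ends.1 hi with rfl | rfl
  · simpa [other] using this.symm
  · simp [other, this]

lemma other_other {e : Pairs n} {i : Fin n} (hi : i ∈ ends e) : other e (other e i) = i := by
  have := ne_of_lt e.2
  rcases mem_ends.1 hi with rfl | rfl
  · simp [other, this]
  · simp [other, this]

lemma ends_eq {e : Pairs n} {i : Fin n} (hi : i ∈ ends e) : ends e = {i, other e i} := by
  have := ne_of_lt e.2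
  rcases mem_ends.1 hi with rfl | rfl
  · simp [other, ends]
  · simp only [other, ends, this, if_false]; exact pair_comm _ _

lemma ends_injective : Function.Injective (ends : Pairs n → Finset (Fin n)) := by
  rintro ⟨⟨i, j⟩, hij⟩ ⟨⟨k, l⟩, hkl⟩ h
  have h1 : i ∈ ends ⟨(k, l), hkl⟩ := by rw [← h]; simp [ends]
  have h2 : j ∈ ends ⟨(k, l), hkl⟩ := by rw [← h]; simp [ends]
  simp only [mem_ends] at h1 h2
  simp only [Subtype.mk.injEq, Prod.mk.injEq]
  simp only at hij hkl
  rcases h1 with rfl | rfl <;> rcases h2 with rfl | rfl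
  · exact absurd hij (lt_irrefl _)
  · exact ⟨rfl, rfl⟩
  · exact absurd hij (not_lt.2 hkl.le)
  · exact absurd hij (lt_irrefl _)

lemma other_injOn {e e' : Pairs n} {i : Fin n} (he : i ∈ ends e) (he' : i ∈ ends e')
    (h : other e i = other e' i) : e = e' := by
  apply ends_injective
  rw [ends_eq he, ends_eq he', h]

lemma edgeSign_congr {l l' : Fin n → Label d} {e : Pairs n} (h : ∀ i ∈ ends e, l i = l' i) :
    edgeSign l e = edgeSign l' e := by
  unfold edgeSign
  rw [h _ (by simp [ends]), h _ (by simp [ends])]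

lemma edgeSign_eq {l : Fin n → Label d} {e : Pairs n} {i : Fin n} (hi : i ∈ ends e) :
    edgeSign l e = table (l i) (l (other e i)) := by
  have := ne_of_lt e.2
  rcases mem_ends.1 hi with rfl | rfl
  · simp [edgeSign, other]
  · simp [edgeSign, other, this, table_comm]

lemma edgeSign_add_single (l : Fin n → Label d) (i : Fin n) (t : Label d) (e : Pairs n) :
    edgeSign (l + Pi.single i t) e =
      (if i ∈ ends e then sgn (formLin t (l (other e i))) else 1) * edgeSign l e := by
  split_ifs with hi
  · rw [edgeSign_eq hi, edgeSign_eq hi]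
    simp only [Pi.add_apply, Pi.single_eq_same, table]
    rw [Pi.single_eq_of_ne (other_ne hi), add_zero, form_add_left, sgn_add, mul_comm]
  · rw [one_mul]
    apply edgeSign_congr
    intro j hj
    have : j ≠ i := fun h => hi (h ▸ hj)
    simp [Pi.single_eq_of_ne this]

/-! ### Moments of products of signs. -/

/-- The product of the block signs over a set of edges. -/
def signProd (l : Fin n → Label d) (γ : Finset (Pairs n)) : ℝ := ∏ e ∈ γ, edgeSign l e

lemma signProd_add_single (l : Fin n → Label d) (i : Fin n) (t : Label d)
    (γ : Finset (Pairs n)) :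
    signProd (l + Pi.single i t) γ =
      sgn (∑ e ∈ γ with i ∈ ends e, formLin t (l (other e i))) * signProd l γ := by
  unfold signProd
  simp only [edgeSign_add_single]
  rw [prod_mul_distrib, sgn_sum, prod_filter]

/-- The edges of `γ` at the vertex `i`. -/
def inc (γ : Finset (Pairs n)) (i : Fin n) : Finset (Pairs n) := {e ∈ γ | i ∈ ends e}

/-- The average of `signProd` over uniform labels. -/
def moment (d : ℕ) (γ : Finset (Pairs n)) : ℝ := 𝔼 l : Fin n → Label d, signProd l γ

lemma moment_empty : moment d (∅ : Finset (Pairs n)) = 1 := by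
  simp [moment, signProd]

/-- Shifting the first component of the label at `i` flips the sign of every edge at `i`, hence
flips the whole product. This is the only role of that component. -/
lemma moment_eq_zero_of_odd {γ : Finset (Pairs n)} {i : Fin n} (h : Odd (inc γ i).card) :
    moment d γ = 0 := by
  have key : moment d γ = - moment d γ := by
    unfold moment
    rw [← expect_neg_distrib]
    refine Fintype.expect_equiv (Equiv.addRight (Pi.single i ((1, 0, 0) : Label d))) _ _ ?_
    intro l
    rw [Equiv.coe_addRight, signProd_add_single]
    have : ∀ y : Label d, formLin (1, 0, 0) y = 1 := by intro y; simp [formLin]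
    simp only [this]
    rw [sgn_sum, prod_const, sgn_one]
    rw [inc] at h
    rw [h.neg_one_pow]; ring
  linarith

/-- The neighbourhood constraints imposed by a set of edges on the labels. -/
def constraint (d : ℕ) (γ : Finset (Pairs n)) :
    (Fin n → Label d) →+ (Fin n → Fin d → ZMod 2) where
  toFun l i := ∑ e ∈ inc γ i, (l (other e i)).2.2
  map_zero' := by ext; simp
  map_add' l l' := by ext; simp [sum_add_distrib]

lemma constraint_apply (γ : Finset (Pairs n)) (l : Fin n → Label d) (i : Fin n) :
    constraint d γ l i = ∑ e ∈ inc γ i, (l (other e i)).2.2 := rfl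

/-- The probability that uniform labels satisfy the neighbourhood constraints. -/
def kerProb (d : ℕ) (γ : Finset (Pairs n)) : ℝ := 1 / ((constraint d γ).ker.index : ℝ)

lemma kerProb_pos (γ : Finset (Pairs n)) : 0 < kerProb d γ := by
  unfold kerProb
  have : (constraint d γ).ker.index ≠ 0 := AddSubgroup.index_ne_zero_of_finite
  positivity

/-- The constraints are additive over disjoint edge sets, and the index of an intersection is at
most the product of the indices. This lets the cumulant recursion absorb a product of two
probabilities into that of the union. -/
lemma kerProb_mul_le {α β : Finset (Pairs n)} (h : Disjoint α β) :
    kerProb d α * kerProb d β ≤ kerProb d (α ∪ β) := by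
  have hle : (constraint d α).ker ⊓ (constraint d β).ker ≤ (constraint d (α ∪ β)).ker := by
    rintro l ⟨h1, h2⟩
    simp only [SetLike.mem_coe, AddMonoidHom.mem_ker] at h1 h2 ⊢
    ext1 i
    have h1 := congrFun h1 i
    have h2 := congrFun h2 i
    rw [constraint_apply] at h1 h2 ⊢
    have : inc (α ∪ β) i = inc α i ∪ inc β i := filter_union ..
    rw [this, Finset.sum_union (by exact disjoint_filter_filter h), h1, h2]; simp
  have h0 : (constraint d (α ∪ β)).ker.index ≠ 0 := AddSubgroup.index_ne_zero_of_finite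
  have h1 := (AddSubgroup.index_antitone hle).trans AddSubgroup.index_inf_le
  unfold kerProb
  rw [div_mul_div_comm, one_mul]
  apply one_div_le_one_div_of_le
  · positivity
  · exact_mod_cast h1

lemma exists_dotProduct_ne_zero {c : Fin d → ZMod 2} (hc : c ≠ 0) :
    ∃ t : Fin d → ZMod 2, t ⬝ᵥ c ≠ 0 := by
  obtain ⟨r, hr⟩ := Function.ne_iff.1 hc
  exact ⟨Pi.single r 1, by simpa using hr⟩

lemma abs_signProd (l : Fin n → Label d) (γ : Finset (Pairs n)) : |signProd l γ| = 1 := by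
  unfold signProd
  rw [abs_prod]
  exact prod_eq_one fun e _ => abs_table _ _

/-- The exponent of the sign is linear in the second components, with the neighbourhood sums of the
third components as coefficients. Averaging over the second components therefore cancels every
labelling that violates a constraint. -/
lemma abs_moment_le (γ : Finset (Pairs n)) : |moment d γ| ≤ kerProb d γ := by
  classical
  have hex : ∀ c : Fin n → Fin d → ZMod 2, ∃ τ : Fin n → Label d, c ≠ 0 →
      ∃ (i : Fin n) (t : Fin d → ZMod 2), τ = Pi.single i (0, t, 0) ∧ t ⬝ᵥ c i ≠ 0 := by
    intro c
    by_cases hc : c = 0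
    · exact ⟨0, fun h => absurd hc h⟩
    · obtain ⟨i, hi⟩ := Function.ne_iff.1 hc
      obtain ⟨t, ht⟩ := exists_dotProduct_ne_zero hi
      exact ⟨_, fun _ => ⟨i, t, rfl, ht⟩⟩
  choose τ hτ using hex
  -- The shift depends on `l` only through its constraint values, which do not see second
  -- components. Hence `tr` preserves those values and, in characteristic two, is an involution; it
  -- reverses the sign wherever a constraint fails.
  let tr : (Fin n → Label d) → (Fin n → Label d) := fun l => l + τ (constraint d γ l)
  have hcon : ∀ l, constraint d γ l ≠ 0 → constraint d γ (tr l) = constraint d γ l := by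
    intro l hl
    obtain ⟨i₀, t, h1, -⟩ := hτ _ hl
    ext1 i
    rw [constraint_apply, constraint_apply]
    refine sum_congr rfl fun e _ => ?_
    simp only [tr, Pi.add_apply, Prod.snd_add, h1]
    by_cases h : other e i = i₀
    · rw [h, Pi.single_eq_same]; simp
    · rw [Pi.single_eq_of_ne h]; simp
  have hsum : ∑ l with ¬ (constraint d γ l = 0), signProd l γ = 0 := by
    refine sum_involution (fun l _ => tr l) ?_ ?_ ?_ ?_
    · intro l hl
      simp only [mem_filter, Finset.mem_univ, true_and] at hl
      obtain ⟨i₀, t, h1, h2⟩ := hτ _ hl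
      have : signProd (tr l) γ = - signProd l γ := by
        simp only [tr, h1]
        rw [signProd_add_single]
        have hlin : ∀ (s : Fin d → ZMod 2) (y : Label d), formLin (0, s, 0) y = s ⬝ᵥ y.2.2 := by
          intro s y; simp [formLin]
        simp only [hlin]
        rw [← dotProduct_sum]
        rw [constraint_apply, inc] at h2
        rw [sgn_eq_neg_one h2]; ring
      rw [this]; ring
    · intro l hl _ heq
      simp only [mem_filter, Finset.mem_univ, true_and] at hl
      obtain ⟨i₀, t, h1, h2⟩ := hτ _ hl
      have h0 : τ (constraint d γ l) = 0 := by simpa [tr] using heq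
      rw [h1, Pi.single_eq_zero_iff] at h0
      simp only [Prod.mk_eq_zero, true_and, and_true] at h0
      exact h2 (by rw [h0, zero_dotProduct])
    · intro l hl
      simp only [mem_filter, Finset.mem_univ, true_and] at hl ⊢
      rwa [hcon l hl]
    · intro l hl
      simp only [mem_filter, Finset.mem_univ, true_and] at hl
      have h2 : tr (tr l) = tr l + τ (constraint d γ (tr l)) := rfl
      rw [h2, hcon l hl]
      simp only [tr]
      rw [add_assoc]
      have h2 : τ (constraint d γ l) + τ (constraint d γ l) = 0 := by
        ext i r <;> exact CharTwo.add_self_eq_zero _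
      rw [h2, add_zero]
  unfold moment kerProb
  rw [Fintype.expect_eq_sum_div_card,
    ← sum_filter_add_sum_filter_not _ (fun l => constraint d γ l = 0), hsum, add_zero, abs_div,
    Nat.abs_cast]
  have hcard := AddSubgroup.card_mul_index (constraint d γ).ker
  have hk : Nat.card (constraint d γ).ker = #{l | constraint d γ l = 0} := by
    rw [← Fintype.card_subtype, ← Nat.card_eq_fintype_card]
    rfl
  rw [hk, Nat.card_eq_fintype_card] at hcard
  have hi : (constraint d γ).ker.index ≠ 0 := AddSubgroup.index_ne_zero_of_finite
  have hle : |∑ l with constraint d γ l = 0, signProd l γ| ≤ #{l | constraint d γ l = 0} := by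
    refine (abs_sum_le_sum_abs _ _).trans ?_
    simp [abs_signProd]
  rw [← hcard]
  push_cast
  have hpos : 0 < #{l | constraint d γ l = 0} :=
    card_pos.2 ⟨0, by simp⟩
  rw [div_le_div_iff₀ (by positivity) (by positivity)]
  nlinarith [show (0:ℝ) ≤ (constraint d γ).ker.index by positivity]

/-- Independence of disjoint blocks of coordinates: exchanging the coordinates outside `S` between
two independent copies is a bijection. -/
lemma expect_mul_of_disjoint {Λ : Type*} [Fintype Λ] [Nonempty Λ] (S : Finset (Fin n))
    (f g : (Fin n → Λ) → ℝ)
    (hf : ∀ l l', (∀ i ∈ S, l i = l' i) → f l = f l')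
    (hg : ∀ l l', (∀ i ∉ S, l i = l' i) → g l = g l') :
    𝔼 l, f l * g l = (𝔼 l, f l) * 𝔼 l, g l := by
  rw [Fintype.expect_mul_expect]
  have h1 : 𝔼 l, f l * g l = 𝔼 l, 𝔼 _l' : Fin n → Λ, f l * g l := by simp
  rw [h1, ← expect_product', ← expect_product']
  refine expect_nbij' (fun z => (S.piecewise z.1 z.2, S.piecewise z.2 z.1))
    (fun z => (S.piecewise z.1 z.2, S.piecewise z.2 z.1)) (by simp) (by simp) ?_ ?_ ?_
  · rintro ⟨a, b⟩ _
    ext i <;> by_cases h : i ∈ S <;> simp [h]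
  · rintro ⟨a, b⟩ _
    ext i <;> by_cases h : i ∈ S <;> simp [h]
  · rintro ⟨a, b⟩ _
    rw [hf a (S.piecewise a b), hg a (S.piecewise b a)]
    · intro i hi; simp [hi]
    · intro i hi; simp [hi]

lemma moment_union {α β : Finset (Pairs n)} (S : Finset (Fin n))
    (hα : ∀ e ∈ α, ends e ⊆ S) (hβ : ∀ e ∈ β, Disjoint (ends e) S) :
    moment d (α ∪ β) = moment d α * moment d β := by
  have hd : Disjoint α β := by
    rw [Finset.disjoint_left]
    intro e h1 h2
    obtain ⟨i, hi⟩ := ends_nonempty e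
    exact Finset.disjoint_left.1 (hβ e h2) hi (hα e h1 hi)
  unfold moment
  rw [← expect_mul_of_disjoint S]
  · simp only [signProd, prod_union hd]
  · intro l l' h
    exact prod_congr rfl fun e he => edgeSign_congr fun i hi => h i (hα e he hi)
  · intro l l' h
    exact prod_congr rfl fun e he => edgeSign_congr fun i hi =>
      h i fun hS => Finset.disjoint_left.1 (hβ e he) hi hS

/-! ### Exploration of a connected even graph and the probability of its constraints. -/

/-- In a connected graph of minimum degree two, explored from the edge `a b`, a function whose
neighbourhood sums vanish is determined by its values on few vertices. -/
lemma exists_determining_set {V M : Type*} [DecidableEq V] [AddCommGroup M]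
    (N : V → Finset V) (C : Finset V) {a b : V} (ha : a ∈ C) (hab : b ∈ N a) (hba : a ∈ N b)
    (hsymm : ∀ i j, j ∈ N i → i ∈ N j)
    (hC : ∀ i ∈ C, N i ⊆ C) (hdeg : ∀ i ∈ C, 2 ≤ (N i).card)
    (hconn : ∀ S ⊆ C, a ∈ S → (∀ i ∈ S, N i ⊆ S) → C ⊆ S) :
    ∃ F ⊆ C, F.card + 2 * C.card ≤ 2 + ∑ i ∈ C, (N i).card ∧
      ∀ w : V → M, (∀ i ∈ C, ∑ j ∈ N i, w j = 0) → (∀ i ∈ F, w i = 0) → ∀ i ∈ C, w i = 0 := by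
  classical
  -- State of the exploration: `P` the processed vertices, `S` the discovered ones, `F` those whose
  -- values are prescribed. The initial `F = {a, b}` accounts for the `2`, and processing `i` may
  -- add at most `deg i - 2` vertices to `F`. A `P` of maximal size must exhaust `C`.
  let Good : Finset V → Prop := fun P => ∃ S ⊆ C, ∃ F ⊆ C, P ⊆ S ∧ a ∈ S ∧
    (∀ i ∈ P, N i ⊆ S) ∧ (∀ i ∈ S, ∃ j ∈ N i, j ∈ S) ∧
    F.card + 2 * P.card ≤ 2 + ∑ i ∈ P, (N i).card ∧
      ∀ w : V → M, (∀ i ∈ C, ∑ j ∈ N i, w j = 0) → (∀ i ∈ F, w i = 0) → ∀ i ∈ S, w i = 0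
  have hb : b ∈ C := hC a ha hab
  have h0 : Good ∅ := by
    have hsub : ({a, b} : Finset V) ⊆ C := by
      intro i hi; simp only [Finset.mem_insert, Finset.mem_singleton] at hi
      rcases hi with rfl | rfl <;> assumption
    refine ⟨{a, b}, hsub, {a, b}, hsub, by simp, by simp, by simp, ?_, ?_, fun w _ h => h⟩
    · intro i hi
      simp only [Finset.mem_insert, Finset.mem_singleton] at hi
      rcases hi with rfl | rfl
      · exact ⟨b, hab, by simp⟩
      · exact ⟨a, hba, by simp⟩
    · simpa using card_le_two
  obtain ⟨P, hP, hmax⟩ := exists_max_image (C.powerset.filter Good) Finset.card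
    ⟨∅, by simp [h0]⟩
  obtain ⟨hPC, S, hSC, F, hFC, hPS, haS, hN, hnb, hcard, hw⟩ := by
    simpa only [mem_filter, Finset.mem_powerset] using hP
  by_cases hSP : S ⊆ P
  · have hPS' : P = S := Finset.Subset.antisymm hPS hSP
    subst hPS'
    have hCP := hconn P hSC haS hN
    have : P = C := Finset.Subset.antisymm hSC hCP
    subst this
    exact ⟨F, hFC, hcard, hw⟩
  exfalso
  obtain ⟨i, hiS, hiP⟩ := Finset.not_subset.1 hSP
  have hiC := hSC hiS
  have hbig : Good (insert i P) → False := by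
    intro h
    have := hmax (insert i P) (by
      simp only [mem_filter, Finset.mem_powerset]
      exact ⟨Finset.insert_subset hiC hPC, h⟩)
    rw [card_insert_of_notMem hiP] at this
    omega
  apply hbig
  by_cases hnew : N i ⊆ S
  · refine ⟨S, hSC, F, hFC, Finset.insert_subset hiS hPS, haS, ?_, hnb, ?_, hw⟩
    · intro j hj
      rcases Finset.mem_insert.1 hj with rfl | hj
      · exact hnew
      · exact hN j hj
    · rw [card_insert_of_notMem hiP, Finset.sum_insert hiP]
      have := hdeg i hiC
      omega
  · obtain ⟨t, htN, htS⟩ := Finset.not_subset.1 hnew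
    -- At least one neighbour of `i` is already discovered, so at most `deg i - 1` are new. All new
    -- ones but `t` are prescribed, and the constraint at `i` then determines the value at `t`.
    set new := N i \ S with hnewdef
    have htnew : t ∈ new := by simp [hnewdef, htN, htS]
    have hnewC : new ⊆ C := sdiff_subset.trans (hC i hiC)
    refine ⟨S ∪ new, Finset.union_subset hSC hnewC, F ∪ new.erase t,
      Finset.union_subset hFC ((erase_subset _ _).trans hnewC), ?_, by simp [haS], ?_, ?_, ?_, ?_⟩
    · exact Finset.insert_subset (by simp [hiS]) (hPS.trans Finset.subset_union_left)
    · intro j hj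
      rcases Finset.mem_insert.1 hj with rfl | hj
      · intro k hk
        by_cases hkS : k ∈ S <;> simp [hkS, hnewdef, hk]
      · exact (hN j hj).trans Finset.subset_union_left
    · intro j hj
      rcases Finset.mem_union.1 hj with hj | hj
      · obtain ⟨k, hk, hkS⟩ := hnb j hj
        exact ⟨k, hk, by simp [hkS]⟩
      · exact ⟨i, hsymm i j (Finset.mem_sdiff.1 hj).1, by simp [hiS]⟩
    · rw [card_insert_of_notMem hiP, Finset.sum_insert hiP]
      obtain ⟨k, hk, hkS⟩ := hnb i hiS
      have h1 : new.card < (N i).card := card_lt_card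
        ⟨sdiff_subset, fun h => (Finset.mem_sdiff.1 (h hk)).2 hkS⟩
      have h2 := card_erase_of_mem htnew
      have h3 := card_union_le F (new.erase t)
      have h4 : 0 < new.card := card_pos.2 ⟨t, htnew⟩
      omega
    · intro w hker hF
      have hS := hw w hker fun j hj => hF j (by simp [hj])
      have hne : ∀ j ∈ N i, j ≠ t → w j = 0 := by
        intro j hj hjt
        by_cases hjS : j ∈ S
        · exact hS j hjS
        · exact hF j (by simp [hjt, hnewdef, hj, hjS])
      have ht : w t = 0 := by
        rw [← hker i hiC]
        exact (sum_eq_single_of_mem t htN hne).symm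
      intro j hj
      rcases Finset.mem_union.1 hj with hj | hj
      · exact hS j hj
      · by_cases hjt : j = t
        · rw [hjt, ht]
        · exact hne j (Finset.mem_sdiff.1 hj).1 hjt

/-- The vertices touched by a set of edges. -/
def verts (γ : Finset (Pairs n)) : Finset (Fin n) := γ.biUnion ends

lemma sum_card_inc (γ : Finset (Pairs n)) (C : Finset (Fin n)) :
    ∑ i ∈ C, (inc γ i).card ≤ 2 * γ.card := by
  simp only [inc, card_filter]
  rw [Finset.sum_comm, mul_comm, ← smul_eq_mul, ← sum_const]
  refine Finset.sum_le_sum fun e _ => ?_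
  rw [← card_filter, ← card_ends e]
  exact card_le_card fun i hi => (mem_filter.1 hi).2

/-- The set of edges `γ` is connected, seen from the edge `e₀`. -/
def ConnectedFrom (e₀ : Pairs n) (γ : Finset (Pairs n)) : Prop :=
  ∀ S : Finset (Fin n), ends e₀ ⊆ S → (∀ e ∈ γ, ends e ⊆ S ∨ Disjoint (ends e) S) →
    ∀ e ∈ γ, ends e ⊆ S

/-- A labelling in the kernel has its third components on `verts γ` determined by those on `F`, so
the index is at least `(2^d)^(V - |F|)`. The bound follows from `|F| ≤ 2 + 2E - 2V`, where `V` and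
`E` count vertices and edges. -/
lemma kerProb_le {e₀ : Pairs n} {γ : Finset (Pairs n)} (h₀ : e₀ ∈ γ)
    (hconn : ConnectedFrom e₀ γ) (heven : ∀ i, Even (inc γ i).card) :
    kerProb d γ * (2 ^ d : ℝ) ^ (3 * (verts γ).card) ≤ (2 ^ d : ℝ) ^ (2 + 2 * γ.card) := by
  classical
  set N : Fin n → Finset (Fin n) := fun i => (inc γ i).image fun e => other e i with hN
  have hinj : ∀ i, Set.InjOn (fun e => other e i) (inc γ i) := by
    intro i e he e' he' h
    exact other_injOn (mem_filter.1 he).2 (mem_filter.1 he').2 h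
  have hNcard : ∀ i, (N i).card = (inc γ i).card := fun i => card_image_of_injOn (hinj i)
  have hmem : ∀ i j, j ∈ N i ↔ ∃ e ∈ γ, i ∈ ends e ∧ other e i = j := by
    intro i j; simp [hN, inc, and_assoc]
  have hsymm : ∀ i j, j ∈ N i → i ∈ N j := by
    intro i j h
    obtain ⟨e, he, hi, rfl⟩ := (hmem i j).1 h
    exact (hmem _ _).2 ⟨e, he, other_mem_ends _ _, other_other hi⟩
  have hends : ∀ e ∈ γ, ends e ⊆ verts γ := fun e he => subset_biUnion_of_mem ends he
  have ha : e₀.1.1 ∈ ends e₀ := by simp [ends]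
  have hb : e₀.1.2 ∈ N e₀.1.1 := (hmem _ _).2 ⟨e₀, h₀, ha, by simp [other]⟩
  obtain ⟨F, hFC, hF, hw⟩ := exists_determining_set (M := Fin d → ZMod 2) N (verts γ)
    (a := e₀.1.1) (b := e₀.1.2) (hends _ h₀ ha) hb (hsymm _ _ hb) hsymm
    (by
      intro i _ j hj
      obtain ⟨e, he, hi, rfl⟩ := (hmem i j).1 hj
      exact hends e he (other_mem_ends _ _))
    (by
      intro i hi
      rw [hNcard]
      obtain ⟨e, he, hi⟩ := mem_biUnion.1 hi
      have hpos : 0 < (inc γ i).card := card_pos.2 ⟨e, mem_filter.2 ⟨he, hi⟩⟩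
      obtain ⟨k, hk⟩ := heven i
      omega)
    (by
      intro S _ haS hcl
      have hcl' : ∀ e ∈ γ, ∀ i ∈ ends e, i ∈ S → ends e ⊆ S := by
        intro e he i hi hiS
        rw [ends_eq hi]
        refine Finset.insert_subset hiS (Finset.singleton_subset_iff.2 (hcl i hiS ?_))
        exact (hmem _ _).2 ⟨e, he, hi, rfl⟩
      intro i hi
      obtain ⟨e, he, hi⟩ := mem_biUnion.1 hi
      refine hconn S (hcl' e₀ h₀ _ ha haS) ?_ e he hi
      intro e he
      by_cases h : ∃ i ∈ ends e, i ∈ S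
      · obtain ⟨i, hi, hiS⟩ := h
        exact Or.inl (hcl' e he i hi hiS)
      · right
        push Not at h
        exact Finset.disjoint_left.2 h)
  have hsum : ∑ i ∈ verts γ, (N i).card ≤ 2 * γ.card := by
    simp only [hNcard]; exact sum_card_inc γ _
  set H := (constraint d γ).ker with hH
  -- Labellings supported off `F`, nonzero only in the third component. Two of them in the same
  -- coset of the kernel coincide, since their difference vanishes on `F` and hence on `verts γ`.
  let emb : ({i // i ∈ verts γ \ F} → Fin d → ZMod 2) → Fin n → Label d := fun c i =>
    if h : i ∈ verts γ \ F then (0, 0, c ⟨i, h⟩) else 0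
  have hinjm : Function.Injective
      (fun z : H × ({i // i ∈ verts γ \ F} → Fin d → ZMod 2) => z.1.1 + emb z.2) := by
    rintro ⟨⟨l, hl⟩, c⟩ ⟨⟨l', hl'⟩, c'⟩ h
    simp only at h
    have hdiff : l - l' = emb c' - emb c := by
      rw [sub_eq_sub_iff_add_eq_add, h, add_comm]
    have hmemH : l - l' ∈ H := H.sub_mem hl hl'
    have hzero : ∀ i ∈ verts γ, ((l - l') i).2.2 = 0 := by
      refine hw (fun i => ((l - l') i).2.2) ?_ ?_
      · intro i _
        have := congrFun (AddMonoidHom.mem_ker.1 hmemH) i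
        rw [constraint_apply] at this
        rw [Finset.sum_image (hinj i)]
        exact this
      · intro i hi
        rw [hdiff]
        have : i ∉ verts γ \ F := fun h => (Finset.mem_sdiff.1 h).2 hi
        simp only [emb, Pi.sub_apply, this, dif_neg, not_false_eq_true, sub_self]; rfl
    have hcc : c = c' := by
      ext1 ⟨i, hi⟩
      have h1 := hzero i (Finset.mem_sdiff.1 hi).1
      rw [hdiff] at h1
      simp only [emb, Pi.sub_apply, hi, dif_pos, Prod.snd_sub] at h1
      exact (sub_eq_zero.1 h1).symm
    subst hcc
    have : l = l' := by simpa using h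
    subst this
    rfl
  have hcard := Nat.card_le_card_of_injective _ hinjm
  rw [Nat.card_prod, ← AddSubgroup.card_mul_index H] at hcard
  have hHpos : 0 < Nat.card H := Nat.card_pos
  have hidx := Nat.le_of_mul_le_mul_left hcard hHpos
  have hc2 : Nat.card ({i // i ∈ verts γ \ F} → Fin d → ZMod 2)
      = (2 ^ d) ^ ((verts γ).card - F.card) := by
    rw [Nat.card_eq_fintype_card, Fintype.card_fun, Fintype.card_fun, Fintype.card_coe,
      card_sdiff_of_subset hFC, ZMod.card, Fintype.card_fin]
  rw [hc2] at hidx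
  have hFle := Finset.card_le_card hFC
  have hnat : (2 ^ d) ^ (3 * (verts γ).card) ≤ (2 ^ d) ^ (2 + 2 * γ.card) * H.index := by
    calc (2 ^ d) ^ (3 * (verts γ).card)
        ≤ (2 ^ d) ^ ((2 + 2 * γ.card) + ((verts γ).card - F.card)) :=
          Nat.pow_le_pow_right (by positivity) (by omega)
      _ = (2 ^ d) ^ (2 + 2 * γ.card) * (2 ^ d) ^ ((verts γ).card - F.card) := pow_add _ _ _
      _ ≤ _ := Nat.mul_le_mul_left _ hidx
  have hi : H.index ≠ 0 := AddSubgroup.index_ne_zero_of_finite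
  have hipos : (0 : ℝ) < H.index := by positivity
  unfold kerProb
  rw [← hH, one_div, inv_mul_le_iff₀ hipos, mul_comm (H.index : ℝ)]
  exact_mod_cast hnat

/-! ### Joint cumulants: vanishing and size. -/

/-- The joint cumulants, with respect to uniform labels, of the block sign of `e₀` and those of the
edges of a set. -/
def cumulant (d : ℕ) (e₀ : Pairs n) (α : Finset (Pairs n)) : ℝ :=
  moment d (insert e₀ α) -
    ∑ β ∈ α.ssubsets.attach, cumulant d e₀ β.1 * moment d (α \ β.1)
termination_by α.card
decreasing_by exact card_lt_card (mem_ssubsets.1 β.2)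

lemma cumulant_eq (e₀ : Pairs n) (α : Finset (Pairs n)) :
    cumulant d e₀ α =
      moment d (insert e₀ α) - ∑ β ∈ α.ssubsets, cumulant d e₀ β * moment d (α \ β) := by
  rw [cumulant, sum_attach _ fun β => cumulant d e₀ β * moment d (α \ β)]

lemma sum_cumulant (e₀ : Pairs n) (α : Finset (Pairs n)) :
    ∑ β ∈ α.powerset, cumulant d e₀ β * moment d (α \ β) = moment d (insert e₀ α) := by
  have h : α.powerset = insert α α.ssubsets := by
    rw [ssubsets, insert_erase (mem_powerset_self α)]
  rw [h, Finset.sum_insert (fun h => (mem_ssubsets.1 h).2 (Finset.Subset.refl _)), Finset.sdiff_self,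
    moment_empty, cumulant_eq]
  ring

/-- In each term of the recursion the degree at `i` splits between `insert e₀ β` and `α \ β`; one of
the two is odd and kills its factor. -/
lemma cumulant_eq_zero_of_odd {e₀ : Pairs n} {i : Fin n} :
    ∀ {α : Finset (Pairs n)}, e₀ ∉ α → Odd (inc (insert e₀ α) i).card → cumulant d e₀ α = 0 := by
  intro α
  induction α using Finset.strongInduction with
  | H α ih =>
    intro h₀ hodd
    rw [cumulant_eq, moment_eq_zero_of_odd hodd, zero_sub, neg_eq_zero]
    refine sum_eq_zero fun β hβ => ?_
    have hss := mem_ssubsets.1 hβ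
    by_cases hb : Odd (inc (insert e₀ β) i).card
    · rw [ih β hss (fun h => h₀ (hss.1 h)) hb, zero_mul]
    · rw [moment_eq_zero_of_odd (i := i), mul_zero]
      have hu : inc (insert e₀ α) i = inc (insert e₀ β) i ∪ inc (α \ β) i := by
        unfold inc
        rw [← filter_union, Finset.insert_union, union_sdiff_of_subset hss.1]
      have hd : Disjoint (inc (insert e₀ β) i) (inc (α \ β) i) := by
        refine disjoint_filter_filter ?_
        rw [Finset.disjoint_insert_left]
        exact ⟨fun h => h₀ (Finset.mem_sdiff.1 h).1, disjoint_sdiff⟩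
      rw [hu, card_union_of_disjoint hd] at hodd
      rw [Nat.not_odd_iff_even] at hb
      exact (Nat.odd_add'.1 hodd).2 hb

/-- Labels inside and outside `S` are independent. By induction only the `β` inside `S` survive in
the recursion, and the outer moment factors out of both terms, which then cancel by `sum_cumulant`.
-/
lemma cumulant_eq_zero_of_splits {e₀ : Pairs n} {S : Finset (Fin n)} (hS : ends e₀ ⊆ S) :
    ∀ {α : Finset (Pairs n)}, (∀ e ∈ α, ends e ⊆ S ∨ Disjoint (ends e) S) →
      (∃ e ∈ α, ¬ ends e ⊆ S) → cumulant d e₀ α = 0 := by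
  classical
  intro α
  induction α using Finset.strongInduction with
  | H α ih =>
    intro hα hex
    set α' := α.filter fun e => ends e ⊆ S with hα'
    set α'' := α.filter fun e => ¬ ends e ⊆ S with hα''
    have hss : α' ⊂ α := by
      refine (filter_ssubset).2 ?_
      simpa using hex
    have hun : α' ∪ α'' = α := filter_union_filter_not_eq _ _
    have hout : ∀ e ∈ α'', Disjoint (ends e) S := fun e he =>
      (hα e (mem_filter.1 he).1).resolve_left (mem_filter.1 he).2
    have hin : ∀ e ∈ α', ends e ⊆ S := fun e he => (mem_filter.1 he).2
    have h1 : moment d (insert e₀ α) = moment d (insert e₀ α') * moment d α'' := by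
      rw [← hun, ← Finset.insert_union]
      exact moment_union S (fun e he => (Finset.mem_insert.1 he).elim (fun h => h ▸ hS) (hin e)) hout
    have h2 : ∑ β ∈ α.ssubsets, cumulant d e₀ β * moment d (α \ β) =
        ∑ β ∈ α'.powerset, cumulant d e₀ β * moment d (α \ β) := by
      symm
      refine Finset.sum_subset ?_ ?_
      · intro β hβ
        exact mem_ssubsets.2 (Finset.ssubset_of_subset_of_ssubset (Finset.mem_powerset.1 hβ) hss)
      · intro β hβ hβ'
        have hβ := mem_ssubsets.1 hβ
        rw [ih β hβ (fun e he => hα e (hβ.1 he)) ?_, zero_mul]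
        by_contra hcon
        push Not at hcon
        exact hβ' (Finset.mem_powerset.2 fun e he => mem_filter.2 ⟨hβ.1 he, hcon e he⟩)
    have h3 : ∀ β ∈ α'.powerset, moment d (α \ β) = moment d (α' \ β) * moment d α'' := by
      intro β hβ
      have hβ := Finset.mem_powerset.1 hβ
      have : α \ β = (α' \ β) ∪ α'' := by
        rw [← hun, Finset.union_sdiff_distrib]
        congr 1
        refine sdiff_eq_self_of_disjoint ?_
        exact (disjoint_filter_filter_not α α _).symm.mono_right hβ
      rw [this]
      exact moment_union S (fun e he => hin e (Finset.mem_sdiff.1 he).1) hout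
    rw [cumulant_eq, h1, h2, Finset.sum_congr rfl fun β hβ => by rw [h3 β hβ, ← mul_assoc],
      ← Finset.sum_mul, sum_cumulant, sub_self]

lemma connectedFrom_of_cumulant_ne_zero {e₀ : Pairs n} {α : Finset (Pairs n)}
    (h : cumulant d e₀ α ≠ 0) : ConnectedFrom e₀ (insert e₀ α) := by
  intro S hS hα e he
  rcases Finset.mem_insert.1 he with rfl | he
  · exact hS
  by_contra hcon
  exact h (cumulant_eq_zero_of_splits hS (fun e he => hα e (Finset.mem_insert_of_mem he))
    ⟨e, he, hcon⟩)

lemma even_of_cumulant_ne_zero {e₀ : Pairs n} {α : Finset (Pairs n)} (h₀ : e₀ ∉ α)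
    (h : cumulant d e₀ α ≠ 0) (i : Fin n) : Even (inc (insert e₀ α) i).card := by
  rw [← Nat.not_odd_iff_even]
  exact fun hodd => h (cumulant_eq_zero_of_odd h₀ hodd)

/-- Compare with the binomial expansion of `(m + 1)^m`: `(b + 1)^b ≤ m^b` for `b < m`, and the top
term `m^m` covers the `1`. -/
lemma one_add_sum_choose_le (m : ℕ) :
    1 + ∑ b ∈ range m, (m.choose b : ℝ) * ((b : ℝ) + 1) ^ b ≤ ((m : ℝ) + 1) ^ m := by
  have h1 : ∑ b ∈ range m, (m.choose b : ℝ) * ((b : ℝ) + 1) ^ b ≤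
      ∑ b ∈ range m, (m : ℝ) ^ b * 1 ^ (m - b) * (m.choose b : ℝ) := by
    refine Finset.sum_le_sum fun b hb => ?_
    rw [one_pow, mul_one, mul_comm]
    have : (b : ℝ) + 1 ≤ m := by exact_mod_cast Finset.mem_range.1 hb
    gcongr
  have h2 : ((m : ℝ) + 1) ^ m =
      ∑ b ∈ range m, (m : ℝ) ^ b * 1 ^ (m - b) * (m.choose b : ℝ) + (m : ℝ) ^ m := by
    rw [add_pow, Finset.sum_range_succ]; simp
  have h3 : (1 : ℝ) ≤ (m : ℝ) ^ m := by
    rcases Nat.eq_zero_or_pos m with rfl | hm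
    · simp
    · exact one_le_pow₀ (by exact_mod_cast hm)
  linarith

/-- By `kerProb_mul_le` every term of the recursion is at most a number times the same `kerProb d
(insert e₀ α)`; the numbers add up by `one_add_sum_choose_le`. -/
lemma abs_cumulant_le {e₀ : Pairs n} :
    ∀ {α : Finset (Pairs n)}, e₀ ∉ α →
      |cumulant d e₀ α| ≤ ((α.card : ℝ) + 1) ^ α.card * kerProb d (insert e₀ α) := by
  intro α
  induction α using Finset.strongInduction with
  | H α ih =>
    intro h₀
    have hk := kerProb_pos (d := d) (insert e₀ α)
    have hterm : ∀ β ∈ α.ssubsets, |cumulant d e₀ β * moment d (α \ β)| ≤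
        ((β.card : ℝ) + 1) ^ β.card * kerProb d (insert e₀ α) := by
      intro β hβ
      have hβ := mem_ssubsets.1 hβ
      have hd : Disjoint (insert e₀ β) (α \ β) := by
        rw [Finset.disjoint_insert_left]
        exact ⟨fun h => h₀ (Finset.mem_sdiff.1 h).1, disjoint_sdiff⟩
      have hu : insert e₀ β ∪ (α \ β) = insert e₀ α := by
        rw [Finset.insert_union, union_sdiff_of_subset hβ.1]
      have h1 := kerProb_mul_le (d := d) hd
      rw [hu] at h1
      rw [abs_mul]
      calc |cumulant d e₀ β| * |moment d (α \ β)|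
          ≤ (((β.card : ℝ) + 1) ^ β.card * kerProb d (insert e₀ β)) * kerProb d (α \ β) :=
            mul_le_mul (ih β hβ fun h => h₀ (hβ.1 h)) (abs_moment_le _) (abs_nonneg _)
              (mul_nonneg (by positivity) (kerProb_pos _).le)
        _ ≤ _ := by rw [mul_assoc]; gcongr
    have hsum : ∑ β ∈ α.ssubsets, ((β.card : ℝ) + 1) ^ β.card =
        ∑ b ∈ range α.card, (α.card.choose b : ℝ) * ((b : ℝ) + 1) ^ b := by
      have h1 := sum_powerset_apply_card (fun b => ((b : ℝ) + 1) ^ b) (x := α)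
      rw [Finset.sum_range_succ] at h1
      have h : α.powerset = insert α α.ssubsets := by
        rw [ssubsets, insert_erase (mem_powerset_self α)]
      rw [h, Finset.sum_insert (fun h => (mem_ssubsets.1 h).2 (Finset.Subset.refl _))] at h1
      simp only [nsmul_eq_mul, Nat.choose_self, Nat.cast_one, one_mul] at h1
      linarith
    calc |cumulant d e₀ α|
        ≤ |moment d (insert e₀ α)| + |∑ β ∈ α.ssubsets, cumulant d e₀ β * moment d (α \ β)| := by
          rw [cumulant_eq]; exact abs_sub _ _
      _ ≤ kerProb d (insert e₀ α) +
          ∑ β ∈ α.ssubsets, ((β.card : ℝ) + 1) ^ β.card * kerProb d (insert e₀ α) :=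
          add_le_add (abs_moment_le _)
            ((abs_sum_le_sum_abs _ _).trans (Finset.sum_le_sum hterm))
      _ = (1 + ∑ b ∈ range α.card, (α.card.choose b : ℝ) * ((b : ℝ) + 1) ^ b) *
          kerProb d (insert e₀ α) := by
          rw [← Finset.sum_mul, hsum]; ring
      _ ≤ _ := by gcongr; exact one_add_sum_choose_le _

lemma cumulant_empty (e₀ : Pairs n) : cumulant d e₀ ∅ = 0 := by
  refine cumulant_eq_zero_of_odd (i := e₀.1.1) (by simp) ?_
  have : inc (insert e₀ (∅ : Finset (Pairs n))) e₀.1.1 = {e₀} := by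
    ext e; simp [inc, mem_ends]; rintro rfl; simp
  rw [this]; simp

/-! ### Counting edge sets and summing the squared cumulants. -/

lemma card_edges_within_le (C : Finset (Fin n)) :
    #{e : Pairs n | ends e ⊆ C} ≤ C.card ^ 2 := by
  rw [sq, ← card_product]
  refine card_le_card_of_injOn (fun e => e.1) ?_ (Subtype.val_injective.injOn)
  intro e he
  have := (mem_filter.1 he).2
  exact Finset.mem_coe.2 (Finset.mem_product.2
    ⟨this (by simp [ends]), this (by simp [ends])⟩)

lemma card_edgeSets_le (e₀ : Pairs n) (C : Finset (Fin n)) (m : ℕ)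
    (B : Finset (Finset (Pairs n))) (hm : ∀ β ∈ B, β.card = m)
    (hC : ∀ β ∈ B, verts (insert e₀ β) = C) : B.card ≤ C.card ^ (2 * m) := by
  have hsub : B ⊆ powersetCard m {e : Pairs n | ends e ⊆ C} := by
    intro β hβ
    rw [Finset.mem_powersetCard]
    refine ⟨fun e he => ?_, hm β hβ⟩
    simp only [mem_filter, Finset.mem_univ, true_and]
    rw [← hC β hβ]
    exact subset_biUnion_of_mem ends (Finset.mem_insert_of_mem he)
  calc B.card ≤ (#{e : Pairs n | ends e ⊆ C}).choose m := by
        rw [← card_powersetCard]; exact Finset.card_le_card hsub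
    _ ≤ (#{e : Pairs n | ends e ⊆ C}) ^ m := Nat.choose_le_pow _ _
    _ ≤ (C.card ^ 2) ^ m := Nat.pow_le_pow_left (card_edges_within_le C) m
    _ = _ := (pow_mul _ _ _).symm

lemma card_supersets_le (e₀ : Pairs n) (V : ℕ) :
    #{C : Finset (Fin n) | ends e₀ ⊆ C ∧ C.card = V} ≤ n ^ (V - 2) := by
  calc #{C : Finset (Fin n) | ends e₀ ⊆ C ∧ C.card = V}
      ≤ (powersetCard (V - 2) (Finset.univ : Finset (Fin n))).card := by
        refine card_le_card_of_injOn (fun C => C \ ends e₀) ?_ ?_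
        · intro C hC
          have hC := (mem_filter.1 hC).2
          simp only [Finset.mem_coe, Finset.mem_powersetCard]
          exact ⟨Finset.subset_univ _, by rw [card_sdiff_of_subset hC.1, hC.2, card_ends]⟩
        · intro C hC C' hC' h
          have hC := (mem_filter.1 hC).2
          have hC' := (mem_filter.1 hC').2
          rw [← Finset.sdiff_union_of_subset hC.1, ← Finset.sdiff_union_of_subset hC'.1]
          simp only at h
          rw [h]
    _ = n.choose (V - 2) := by simp
    _ ≤ _ := Nat.choose_le_pow _ _

/-- There are at most `n^(V-2)` sets of each size `V`, so each of the `m` sizes from `2` to `m + 1`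
contributes at most one. -/
lemma sum_supersets_le (e₀ : Pairs n) (hn : 0 < n) (m : ℕ) :
    ∑ C : Finset (Fin n) with ends e₀ ⊆ C ∧ C.card ≤ m + 1, (1 : ℝ) / n ^ (C.card - 2) ≤ m := by
  rw [← sum_fiberwise_of_maps_to (t := Finset.Icc 2 (m + 1)) (g := Finset.card)]
  · calc ∑ V ∈ Finset.Icc 2 (m + 1), ∑ C ∈ {C : Finset (Fin n) | ends e₀ ⊆ C ∧
          C.card ≤ m + 1} with C.card = V, (1 : ℝ) / n ^ (C.card - 2)
        ≤ ∑ V ∈ Finset.Icc 2 (m + 1), (1 : ℝ) := by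
          refine Finset.sum_le_sum fun V hV => ?_
          have h1 : ∑ C ∈ {C : Finset (Fin n) | ends e₀ ⊆ C ∧
              C.card ≤ m + 1} with C.card = V, (1 : ℝ) / n ^ (C.card - 2) ≤
              ∑ C : Finset (Fin n) with ends e₀ ⊆ C ∧ C.card = V, (1 : ℝ) / n ^ (V - 2) := by
            rw [Finset.sum_congr rfl (g := fun _ => (1 : ℝ) / n ^ (V - 2))
              fun C hC => by rw [(mem_filter.1 hC).2]]
            refine sum_le_sum_of_subset_of_nonneg ?_ fun _ _ _ => by positivity
            intro C hC
            simp only [mem_filter, Finset.mem_univ, true_and] at hC ⊢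
            exact ⟨hC.1.1, hC.2⟩
          refine h1.trans ?_
          rw [sum_const, nsmul_eq_mul, mul_one_div, div_le_one (by positivity)]
          exact_mod_cast card_supersets_le e₀ V
      _ = m := by simp
  · intro C hC
    have hC := (mem_filter.1 hC).2
    have := Finset.card_le_card hC.1
    rw [card_ends] at this
    exact Finset.mem_Icc.2 ⟨this, hC.2⟩

/-- Every touched vertex has even positive degree, hence degree at least two. -/
lemma card_verts_le {γ : Finset (Pairs n)} (h : ∀ i, Even (inc γ i).card) :
    (verts γ).card ≤ γ.card := by
  have h1 := sum_card_inc γ (verts γ)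
  have h2 : ∑ i ∈ verts γ, 2 ≤ ∑ i ∈ verts γ, (inc γ i).card := by
    refine Finset.sum_le_sum fun i hi => ?_
    obtain ⟨e, he, hi⟩ := mem_biUnion.1 hi
    have hpos : 0 < (inc γ i).card := card_pos.2 ⟨e, mem_filter.2 ⟨he, hi⟩⟩
    obtain ⟨k, hk⟩ := h i
    omega
  rw [sum_const, smul_eq_mul] at h2
  omega

/-- The factor `n^(-(V-2))` on the right is exactly what the count of vertex sets containing the
ends of `e₀` consumes. -/
lemma cumulant_sq_mul_le {e₀ : Pairs n} {β : Finset (Pairs n)} (h₀ : e₀ ∉ β)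
    (hne : cumulant d e₀ β ≠ 0) (hn : ((4 : ℝ) ^ d) ^ 3 ≤ n) :
    cumulant d e₀ β ^ 2 * ((4 : ℝ) ^ d / n) ^ β.card ≤
      ((β.card : ℝ) + 1) ^ (2 * β.card) * (1 / (n : ℝ) ^ ((verts (insert e₀ β)).card - 2)) := by
  have heven := even_of_cumulant_ne_zero h₀ hne
  have hV := card_verts_le heven
  have hker := kerProb_le (d := d) (Finset.mem_insert_self e₀ β) (connectedFrom_of_cumulant_ne_zero hne)
    heven
  have hkpos := kerProb_pos (d := d) (insert e₀ β)
  have habs := abs_cumulant_le (d := d) h₀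
  rw [card_insert_of_notMem h₀] at hV hker
  have hV2 : 2 ≤ (verts (insert e₀ β)).card := by
    rw [← card_ends e₀]
    exact Finset.card_le_card (subset_biUnion_of_mem ends (Finset.mem_insert_self e₀ β))
  set ν := kerProb d (insert e₀ β)
  set m := β.card
  obtain ⟨v, hv⟩ : ∃ v, (verts (insert e₀ β)).card = v + 2 := ⟨_, (Nat.sub_add_cancel hV2).symm⟩
  obtain ⟨r, hr⟩ : ∃ r, m = v + r := ⟨m - v, by omega⟩
  rw [hv] at hker ⊢
  simp only [Nat.add_sub_cancel]
  set Q : ℝ := 4 ^ d with hQ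
  have hQq : Q = ((2 : ℝ) ^ d) ^ 2 := by rw [hQ, ← pow_mul, mul_comm, pow_mul]; norm_num
  have hQ1 : 1 ≤ Q := one_le_pow₀ (by norm_num)
  have hsq : ν ^ 2 * Q ^ (3 * (v + 2)) ≤ Q ^ (2 + 2 * (m + 1)) := by
    have := pow_le_pow_left₀ (by positivity) hker 2
    rw [mul_pow] at this
    rwa [hQq, pow_right_comm _ 2, pow_right_comm _ 2]
  have hn0 : (0 : ℝ) < n := lt_of_lt_of_le (by positivity) hn
  -- With `V = v + 2`, `m + 1` edges and `m = v + r`, the square of `kerProb_le` leaves at most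
  -- `Q^(3r - 2)`. Each excess edge thus costs `Q³`, which is why `Q³ ≤ n` is required.
  have hkey : ν ^ 2 * Q ^ m ≤ (n : ℝ) ^ r := by
    have h1 : ν ^ 2 * Q ^ m * Q ^ (3 * (v + 2)) ≤ (Q ^ 3) ^ r * Q ^ (3 * (v + 2)) := by
      calc ν ^ 2 * Q ^ m * Q ^ (3 * (v + 2)) = ν ^ 2 * Q ^ (3 * (v + 2)) * Q ^ m := by ring
        _ ≤ Q ^ (2 + 2 * (m + 1)) * Q ^ m := by gcongr
        _ = Q ^ (2 + 2 * (m + 1) + m) := (pow_add _ _ _).symm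
        _ ≤ Q ^ (3 * r + 3 * (v + 2)) := pow_le_pow_right₀ hQ1 (by omega)
        _ = _ := by ring
    have h2 := le_of_mul_le_mul_right h1 (by positivity)
    exact h2.trans (pow_le_pow_left₀ (by positivity) hn r)
  have hc : cumulant d e₀ β ^ 2 ≤ ((m : ℝ) + 1) ^ (2 * m) * ν ^ 2 := by
    rw [← sq_abs]
    refine (pow_le_pow_left₀ (abs_nonneg _) habs 2).trans (le_of_eq ?_)
    rw [mul_pow, ← pow_mul, mul_comm m 2]
  calc cumulant d e₀ β ^ 2 * (Q / n) ^ m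
      ≤ ((m : ℝ) + 1) ^ (2 * m) * ν ^ 2 * (Q / n) ^ m := by gcongr
    _ = ((m : ℝ) + 1) ^ (2 * m) * (ν ^ 2 * Q ^ m / n ^ m) := by rw [div_pow]; ring
    _ ≤ ((m : ℝ) + 1) ^ (2 * m) * ((n : ℝ) ^ r / n ^ m) := by gcongr
    _ = _ := by
        rw [hr, pow_add]
        field_simp

/-- The total weight of the cumulants of order at most `D` is small. -/
lemma sum_cumulant_sq_le (e₀ : Pairs n) {D : ℕ} (hn : ((4 : ℝ) ^ d) ^ 3 ≤ n)
    {η : ℝ} (hη : 0 ≤ η) (hη' : η ≤ 1 / 160) :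
    ∑ β : Finset (Pairs n) with e₀ ∉ β ∧ β.card ≤ D,
      cumulant d e₀ β ^ 2 * (η * 4 ^ d / (n * (D : ℝ) ^ 4)) ^ β.card ≤ 1 / 4 := by
  classical
  have hn0 : (0 : ℝ) < n := lt_of_lt_of_le (by positivity) hn
  have hn0' : 0 < n := by exact_mod_cast hn0
  set f : Finset (Pairs n) → ℝ := fun β =>
    cumulant d e₀ β ^ 2 * (η * 4 ^ d / (n * (D : ℝ) ^ 4)) ^ β.card with hf
  set B : Finset (Finset (Pairs n)) :=
    {β | (e₀ ∉ β ∧ β.card ≤ D) ∧ cumulant d e₀ β ≠ 0} with hB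
  have hmemB : ∀ β, β ∈ B ↔ (e₀ ∉ β ∧ β.card ≤ D) ∧ cumulant d e₀ β ≠ 0 := by
    intro β; simp [hB]
  have h1 : ∑ β : Finset (Pairs n) with e₀ ∉ β ∧ β.card ≤ D, f β = ∑ β ∈ B, f β := by
    symm
    refine Finset.sum_subset ?_ ?_
    · intro β hβ
      simpa using ((hmemB β).1 hβ).1
    · intro β hβ hβ'
      have : cumulant d e₀ β = 0 := by
        by_contra h
        exact hβ' ((hmemB β).2 ⟨by simpa using hβ, h⟩)
      simp [hf, this]
  rw [h1]
  have hcard1 : ∀ β ∈ B, β.card ∈ Finset.Icc 1 D := by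
    intro β hβ
    rw [hmemB] at hβ
    refine Finset.mem_Icc.2 ⟨?_, hβ.1.2⟩
    rw [Nat.one_le_iff_ne_zero, Ne, card_eq_zero]
    rintro rfl
    exact hβ.2 (cumulant_empty e₀)
  set 𝒞 : ℕ → Finset (Finset (Fin n)) := fun m => {C | ends e₀ ⊆ C ∧ C.card ≤ m + 1} with h𝒞
  rw [← sum_fiberwise_of_maps_to (t := Finset.Icc 1 D) (g := Finset.card) hcard1]
  -- Group by the vertex set. The cumulant bound and the count of edge sets each give `(m + 1)^(2m)
  -- ≤ (2D)^(2m)`, and together they are absorbed by `D^(4m)` up to `16^m`. The number of sizes is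
  -- at most `2^m`, and `32 η ≤ 1/5`.
  have hm : ∀ m ∈ Finset.Icc 1 D, ∑ β ∈ B with β.card = m, f β ≤ (1 / 5) ^ m := by
    intro m hm
    have hm1 := (Finset.mem_Icc.1 hm).1
    have hmD := (Finset.mem_Icc.1 hm).2
    have hD0 : (0 : ℝ) < D := by exact_mod_cast (by omega : 0 < D)
    have hmaps : ∀ β ∈ B.filter (fun β => β.card = m), verts (insert e₀ β) ∈ 𝒞 m := by
      intro β hβ
      obtain ⟨hβ, hβm⟩ := mem_filter.1 hβ
      rw [hmemB] at hβ
      simp only [h𝒞, mem_filter, Finset.mem_univ, true_and]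
      refine ⟨subset_biUnion_of_mem ends (Finset.mem_insert_self e₀ β), ?_⟩
      have := card_verts_le (even_of_cumulant_ne_zero hβ.1.1 hβ.2)
      rwa [card_insert_of_notMem hβ.1.1, hβm] at this
    rw [← sum_fiberwise_of_maps_to hmaps]
    have hfle : ∀ C ∈ 𝒞 m, ∑ β ∈ B.filter (fun β => β.card = m) with verts (insert e₀ β) = C, f β ≤
        (16 * η) ^ m * (1 / (n : ℝ) ^ (C.card - 2)) := by
      intro C hC
      have hCm : C.card ≤ m + 1 := (mem_filter.1 hC).2.2
      have hterm : ∀ β ∈ (B.filter (fun β => β.card = m)).filter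
          (fun β => verts (insert e₀ β) = C),
          f β ≤ (η / (D : ℝ) ^ 4) ^ m * (((m : ℝ) + 1) ^ (2 * m) * (1 / (n : ℝ) ^ (C.card - 2))) := by
        intro β hβ
        obtain ⟨hβ, hβC⟩ := mem_filter.1 hβ
        obtain ⟨hβ, hβm⟩ := mem_filter.1 hβ
        rw [hmemB] at hβ
        have := cumulant_sq_mul_le hβ.1.1 hβ.2 hn
        rw [hβC, hβm] at this
        simp only [hf, hβm]
        calc cumulant d e₀ β ^ 2 * (η * 4 ^ d / (n * (D : ℝ) ^ 4)) ^ m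
            = (η / (D : ℝ) ^ 4) ^ m * (cumulant d e₀ β ^ 2 * ((4 : ℝ) ^ d / n) ^ m) := by
              rw [show η * 4 ^ d / (n * (D : ℝ) ^ 4) = (η / (D : ℝ) ^ 4) * ((4 : ℝ) ^ d / n) by
                field_simp, mul_pow]
              ring
          _ ≤ _ := by gcongr
      refine (Finset.sum_le_card_nsmul _ _ _ hterm).trans ?_
      rw [nsmul_eq_mul]
      have hcnt := card_edgeSets_le e₀ C m ((B.filter (fun β => β.card = m)).filter
          (fun β => verts (insert e₀ β) = C))
          (fun β hβ => (mem_filter.1 (mem_filter.1 hβ).1).2) (fun β hβ => (mem_filter.1 hβ).2)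
      have hcnt' : (#((B.filter (fun β => β.card = m)).filter
          (fun β => verts (insert e₀ β) = C)) : ℝ) ≤ ((m : ℝ) + 1) ^ (2 * m) := by
        calc (#((B.filter (fun β => β.card = m)).filter
            (fun β => verts (insert e₀ β) = C)) : ℝ) ≤ (C.card : ℝ) ^ (2 * m) := by
              exact_mod_cast hcnt
          _ ≤ _ := by gcongr; exact_mod_cast hCm
      have h2D : (m : ℝ) + 1 ≤ 2 * D := by
        have : m + 1 ≤ 2 * D := by omega
        exact_mod_cast this
      calc _ ≤ ((m : ℝ) + 1) ^ (2 * m) * ((η / (D : ℝ) ^ 4) ^ m *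
              (((m : ℝ) + 1) ^ (2 * m) * (1 / (n : ℝ) ^ (C.card - 2)))) := by gcongr
        _ ≤ (2 * (D : ℝ)) ^ (2 * m) * ((η / (D : ℝ) ^ 4) ^ m *
              ((2 * (D : ℝ)) ^ (2 * m) * (1 / (n : ℝ) ^ (C.card - 2)))) := by gcongr
        _ = (16 * η) ^ m * (1 / (n : ℝ) ^ (C.card - 2)) := by
            have : (2 * (D : ℝ)) ^ (2 * m) * (2 * (D : ℝ)) ^ (2 * m) * (η / (D : ℝ) ^ 4) ^ m =
                (16 * η) ^ m := by
              rw [← pow_add, show 2 * m + 2 * m = 4 * m by ring, pow_mul, ← mul_pow]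
              congr 1
              field_simp
              ring
            rw [← this]; ring
    refine (Finset.sum_le_sum hfle).trans ?_
    rw [← Finset.mul_sum]
    have hm2 : (m : ℝ) ≤ 2 ^ m := by exact_mod_cast (Nat.lt_two_pow_self).le
    calc (16 * η) ^ m * ∑ C ∈ 𝒞 m, 1 / (n : ℝ) ^ (C.card - 2)
        ≤ (16 * η) ^ m * 2 ^ m := by
          gcongr
          exact (sum_supersets_le e₀ hn0' m).trans hm2
      _ = (32 * η) ^ m := by rw [← mul_pow]; ring_nf
      _ ≤ _ := by gcongr; linarith
  refine (Finset.sum_le_sum hm).trans ?_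
  have hgeo : ∀ D : ℕ, ∑ m ∈ Finset.Icc 1 D, ((1 : ℝ) / 5) ^ m = 1 / 4 - (1 / 5) ^ D / 4 := by
    intro D
    induction D with
    | zero => simp
    | succ D ih => rw [sum_Icc_succ_top (by omega), ih, pow_succ]; ring
  rw [hgeo]
  have : (0 : ℝ) ≤ (1 / 5) ^ D / 4 := by positivity
  linarith

/-! ### Independent Bernoulli edges: biorthogonality and low degree functions. -/

section Bernoulli

variable {E : Type*} [Fintype E]

/-- The indicator of an edge. -/
def ind (b : Bool) : ℝ := if b then 1 else 0

/-- The probability of `a` for independent Bernoulli variables of means `M`. -/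
def bernWeight (M : E → ℝ) (a : E → Bool) : ℝ := ∏ e, if a e then M e else 1 - M e

/-- The expectation for independent Bernoulli variables of means `M`. -/
def bernExp [DecidableEq E] (M : E → ℝ) : ((E → Bool) → ℝ) →ₗ[ℝ] ℝ where
  toFun F := ∑ a, bernWeight M a * F a
  map_add' F G := by simp [mul_add, Finset.sum_add_distrib]
  map_smul' c F := by
    simp only [Pi.smul_apply, smul_eq_mul, RingHom.id_apply, Finset.mul_sum]
    exact Finset.sum_congr rfl fun a _ => by ring

lemma bernExp_apply [DecidableEq E] (M : E → ℝ) (F : (E → Bool) → ℝ) :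
    bernExp M F = ∑ a, bernWeight M a * F a := rfl

lemma bernWeight_nonneg {M : E → ℝ} (h : ∀ e, M e ∈ Set.Icc (0 : ℝ) 1) (a : E → Bool) :
    0 ≤ bernWeight M a := by
  refine Finset.prod_nonneg fun e _ => ?_
  have := h e
  split_ifs
  · exact this.1
  · linarith [this.2]

lemma bernExp_nonneg [DecidableEq E] {M : E → ℝ} (h : ∀ e, M e ∈ Set.Icc (0 : ℝ) 1) {F : (E → Bool) → ℝ}
    (hF : ∀ a, 0 ≤ F a) : 0 ≤ bernExp M F :=
  Finset.sum_nonneg fun a _ => mul_nonneg (bernWeight_nonneg h a) (hF a)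

variable [DecidableEq E]

lemma bernExp_prod (M : E → ℝ) (φ : E → Bool → ℝ) :
    bernExp M (fun a => ∏ e, φ e (a e)) = ∏ e, (M e * φ e true + (1 - M e) * φ e false) := by
  rw [bernExp_apply]
  have : ∀ e, M e * φ e true + (1 - M e) * φ e false =
      ∑ b : Bool, (if b then M e else 1 - M e) * φ e b := by
    intro e; simp
  simp only [this]
  rw [prod_univ_sum, Fintype.piFinset_univ]
  refine Finset.sum_congr rfl fun a _ => ?_
  rw [bernWeight, ← prod_mul_distrib]

/-- The centred monomials. -/
def centred (p : ℝ) (α : Finset E) (a : E → Bool) : ℝ := ∏ e ∈ α, (ind (a e) - p)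

/-- The dual monomials: products of standardised residuals. -/
def residual (M : E → ℝ) (β : Finset E) (a : E → Bool) : ℝ :=
  ∏ e ∈ β, (ind (a e) - M e) / (M e * (1 - M e))

/-- The expectation factors over edges. A residual has mean zero and pairs to one with `ind - p`,
whatever `p`, so edges in `β` outside `α` kill the product and those in both contribute one. -/
lemma bernExp_centred_mul_residual {M : E → ℝ} (h0 : ∀ e, M e ≠ 0) (h1 : ∀ e, 1 - M e ≠ 0)
    (p : ℝ) (α β : Finset E) :
    bernExp M (fun a => centred p α a * residual M β a) =
      if β ⊆ α then ∏ e ∈ α \ β, (M e - p) else 0 := by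
  have : (fun a => centred p α a * residual M β a) = fun a => ∏ e,
      (if e ∈ α then ind (a e) - p else 1) *
        (if e ∈ β then (ind (a e) - M e) / (M e * (1 - M e)) else 1) := by
    ext a
    rw [prod_mul_distrib, centred, residual]
    simp [Finset.prod_ite_mem]
  rw [this, bernExp_prod M fun e b => (if e ∈ α then ind b - p else 1) *
        (if e ∈ β then (ind b - M e) / (M e * (1 - M e)) else 1)]
  have hval : ∀ e, M e * ((if e ∈ α then ind true - p else 1) *
        (if e ∈ β then (ind true - M e) / (M e * (1 - M e)) else 1)) +
      (1 - M e) * ((if e ∈ α then ind false - p else 1) *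
        (if e ∈ β then (ind false - M e) / (M e * (1 - M e)) else 1)) =
      if e ∈ β then (if e ∈ α then 1 else 0) else (if e ∈ α then M e - p else 1) := by
    intro e
    have := h0 e
    have := h1 e
    simp only [ind, if_true, Bool.false_eq_true, if_false]
    split_ifs <;> field_simp <;> ring
  simp only [hval]
  split_ifs with hs
  · rw [← prod_subset (Finset.subset_univ (α \ β))]
    · refine Finset.prod_congr rfl fun e he => ?_
      obtain ⟨h1, h2⟩ := Finset.mem_sdiff.1 he
      simp [h1, h2]
    · intro e _ he
      by_cases hb : e ∈ β
      · simp [hb, hs hb]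
      · have : e ∉ α := fun h => he (Finset.mem_sdiff.2 ⟨h, hb⟩)
        simp [hb, this]
  · obtain ⟨e, he, he'⟩ := Finset.not_subset.1 hs
    exact prod_eq_zero (Finset.mem_univ e) (by simp [he, he'])

lemma bernExp_residual_mul_residual {M : E → ℝ} (h0 : ∀ e, M e ≠ 0) (h1 : ∀ e, 1 - M e ≠ 0)
    (α β : Finset E) :
    bernExp M (fun a => residual M α a * residual M β a) =
      if α = β then ∏ e ∈ α, 1 / (M e * (1 - M e)) else 0 := by
  have : (fun a => residual M α a * residual M β a) = fun a => ∏ e,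
      (if e ∈ α then (ind (a e) - M e) / (M e * (1 - M e)) else 1) *
        (if e ∈ β then (ind (a e) - M e) / (M e * (1 - M e)) else 1) := by
    ext a
    rw [prod_mul_distrib, residual, residual]
    simp [Finset.prod_ite_mem]
  rw [this, bernExp_prod M fun e b => (if e ∈ α then (ind b - M e) / (M e * (1 - M e)) else 1) *
        (if e ∈ β then (ind b - M e) / (M e * (1 - M e)) else 1)]
  have hval : ∀ e, M e * ((if e ∈ α then (ind true - M e) / (M e * (1 - M e)) else 1) *
        (if e ∈ β then (ind true - M e) / (M e * (1 - M e)) else 1)) +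
      (1 - M e) * ((if e ∈ α then (ind false - M e) / (M e * (1 - M e)) else 1) *
        (if e ∈ β then (ind false - M e) / (M e * (1 - M e)) else 1)) =
      if e ∈ β then (if e ∈ α then 1 / (M e * (1 - M e)) else 0)
        else (if e ∈ α then 0 else 1) := by
    intro e
    have := h0 e
    have := h1 e
    simp only [ind, if_true, Bool.false_eq_true, if_false]
    split_ifs <;> field_simp <;> ring
  simp only [hval]
  split_ifs with hs
  · subst hs
    rw [← prod_subset (Finset.subset_univ α)]
    · exact Finset.prod_congr rfl fun e he => by simp [he]
    · intro e _ he
      simp [he]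
  · have : ∃ e, ¬ (e ∈ α ↔ e ∈ β) := by
      by_contra hcon
      push Not at hcon
      exact hs (Finset.ext hcon)
    obtain ⟨e, he⟩ := this
    refine prod_eq_zero (Finset.mem_univ e) ?_
    by_cases ha : e ∈ α <;> by_cases hb : e ∈ β <;> simp_all

lemma bernExp_centred_mul_sum {M : E → ℝ} (h0 : ∀ e, M e ≠ 0) (h1 : ∀ e, 1 - M e ≠ 0)
    (p : ℝ) (α : Finset E) (c : Finset E → ℝ) :
    bernExp M (fun a => centred p α a * ∑ β, c β * residual M β a) =
      ∑ β ∈ α.powerset, c β * ∏ e ∈ α \ β, (M e - p) := by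
  have : (fun a => centred p α a * ∑ β, c β * residual M β a) =
      ∑ β, c β • fun a => centred p α a * residual M β a := by
    ext a
    simp only [Finset.sum_apply, Pi.smul_apply, smul_eq_mul, Finset.mul_sum]
    exact Finset.sum_congr rfl fun β _ => by ring
  rw [this, map_sum]
  simp only [map_smul, bernExp_centred_mul_residual h0 h1, smul_eq_mul, mul_ite, mul_zero]
  rw [← Finset.sum_filter]
  refine Finset.sum_congr ?_ fun _ _ => rfl
  ext β; simp

lemma bernExp_sum_sq {M : E → ℝ} (h0 : ∀ e, M e ≠ 0) (h1 : ∀ e, 1 - M e ≠ 0)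
    (c : Finset E → ℝ) :
    bernExp M (fun a => (∑ β, c β * residual M β a) ^ 2) =
      ∑ β, c β ^ 2 * ∏ e ∈ β, 1 / (M e * (1 - M e)) := by
  have : (fun a => (∑ β, c β * residual M β a) ^ 2) =
      ∑ β, ∑ β', (c β * c β') • fun a => residual M β a * residual M β' a := by
    ext a
    simp only [Finset.sum_apply, Pi.smul_apply, smul_eq_mul]
    rw [sq, Finset.sum_mul_sum]
    exact Finset.sum_congr rfl fun β _ => Finset.sum_congr rfl fun β' _ => by ring
  rw [this, map_sum]
  simp only [map_sum, map_smul, bernExp_residual_mul_residual h0 h1, smul_eq_mul, mul_ite,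
    mul_zero, Finset.sum_ite_eq, Finset.mem_univ, if_true]
  exact Finset.sum_congr rfl fun β _ => by ring

/-- The functions of the edge indicators that are multilinear of degree at most `D`. -/
def lowDegree (E : Type*) [Fintype E] [DecidableEq E] (D : ℕ) : Submodule ℝ ((E → Bool) → ℝ) :=
  Submodule.span ℝ {g | ∃ α : Finset E, α.card ≤ D ∧ g = fun a => ∏ e ∈ α, ind (a e)}

lemma prod_ind_eq {ι : Type*} [DecidableEq ι] (p : ℝ) (α : Finset ι) (a : ι → Bool) :
    ∏ e ∈ α, ind (a e) = ∑ β ∈ α.powerset, p ^ (α \ β).card * centred p β a := by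
  have : ∀ e, ind (a e) = (ind (a e) - p) + p := fun e => by ring
  calc ∏ e ∈ α, ind (a e) = ∏ e ∈ α, ((ind (a e) - p) + p) := by simp
    _ = _ := by
      rw [prod_add]
      refine Finset.sum_congr rfl fun β _ => ?_
      rw [prod_const, centred, mul_comm]

/-- A linear functional vanishing on the centred monomials vanishes on low degree functions. -/
lemma eq_zero_of_lowDegree {D : ℕ} (p : ℝ) (Φ : ((E → Bool) → ℝ) →ₗ[ℝ] ℝ)
    (hΦ : ∀ α : Finset E, α.card ≤ D → Φ (centred p α) = 0) {g : (E → Bool) → ℝ}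
    (hg : g ∈ lowDegree E D) : Φ g = 0 := by
  have : lowDegree E D ≤ LinearMap.ker Φ := by
    rw [lowDegree, Submodule.span_le]
    rintro _ ⟨α, hα, rfl⟩
    rw [SetLike.mem_coe, LinearMap.mem_ker]
    have : (fun a => ∏ e ∈ α, ind (a e)) =
        ∑ β ∈ α.powerset, p ^ (α \ β).card • centred p β := by
      ext a
      simp [prod_ind_eq p α a, Finset.sum_apply]
    rw [this, map_sum]
    refine Finset.sum_eq_zero fun β hβ => ?_
    rw [map_smul, hΦ β ((Finset.card_le_card (Finset.mem_powerset.1 hβ)).trans hα), smul_zero]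
  exact this hg

end Bernoulli

/-! ### The dual certificate and the error bound for one edge. -/

section Certificate

/-- The coefficients of the dual certificate for the edge `e₀`. -/
def certCoeff (d : ℕ) (lam : ℝ) (D : ℕ) (e₀ : Pairs n) (l : Fin n → Label d)
    (β : Finset (Pairs n)) : ℝ :=
  if β.card ≤ D then
    if e₀ ∈ β then
      (if β = {e₀} then lam ^ 2 else 0) - lam * edgeSign l e₀ *
        (lam ^ β.card * cumulant d e₀ (β.erase e₀))
    else lam ^ (β.card + 1) * cumulant d e₀ β
  else 0

/-- This is the orthogonality condition tested on the centred monomial of `α`. If `e₀ ∉ α` it is the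
cumulant recursion `sum_cumulant`. If `e₀ ∈ α` the terms for `β` and `insert e₀ β` cancel, except
for the extra `lam ^ 2` at `{e₀}`, which is the right side because the sign of `e₀` squares to one.
-/
lemma sum_certCoeff {lam : ℝ} {D : ℕ} {e₀ : Pairs n} {α : Finset (Pairs n)} (hα : α.card ≤ D) :
    𝔼 l : Fin n → Label d, ∑ β ∈ α.powerset, certCoeff d lam D e₀ l β *
        ∏ e ∈ α \ β, lam * edgeSign l e =
      𝔼 l : Fin n → Label d, lam * edgeSign l e₀ * ∏ e ∈ α, lam * edgeSign l e := by
  have hcard : ∀ β ∈ α.powerset, β.card ≤ D := fun β hβ =>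
    (Finset.card_le_card (Finset.mem_powerset.1 hβ)).trans hα
  have hprod : ∀ (γ : Finset (Pairs n)) (l : Fin n → Label d),
      ∏ e ∈ γ, lam * edgeSign l e = lam ^ γ.card * signProd l γ := by
    intro γ l
    rw [prod_mul_distrib, prod_const, signProd]
  simp only [hprod]
  by_cases h₀ : e₀ ∈ α
  -- Here the identity holds for each labelling, before averaging.
  · refine Fintype.expect_equiv (Equiv.refl _) _ _ fun l => ?_
    simp only [Equiv.refl_apply]
    set α' := α.erase e₀ with hα'
    have h₀' : e₀ ∉ α' := notMem_erase _ _
    have hins : insert e₀ α' = α := insert_erase h₀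
    rw [← hins] at hcard ⊢
    rw [sum_powerset_insert h₀', ← Finset.sum_add_distrib]
    have hterm : ∀ β ∈ α'.powerset,
        certCoeff d lam D e₀ l β * (lam ^ (insert e₀ α' \ β).card *
            signProd l (insert e₀ α' \ β)) +
          certCoeff d lam D e₀ l (insert e₀ β) * (lam ^ (insert e₀ α' \ insert e₀ β).card *
            signProd l (insert e₀ α' \ insert e₀ β)) =
        if β = ∅ then lam ^ 2 * (lam ^ α'.card * signProd l α') else 0 := by
      intro β hβ
      have hβ' := Finset.mem_powerset.1 hβ
      have hn : e₀ ∉ β := fun h => h₀' (hβ' h)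
      have h1 : insert e₀ α' \ β = insert e₀ (α' \ β) := insert_sdiff_of_notMem _ hn
      have hn2 : e₀ ∉ α' \ β := fun h => h₀' (Finset.mem_sdiff.1 h).1
      have h2 : insert e₀ α' \ insert e₀ β = α' \ β := by
        ext e
        simp only [Finset.mem_sdiff, Finset.mem_insert]
        by_cases he : e = e₀
        · subst he; simp [h₀']
        · simp [he]
      have hc1 := hcard β (Finset.mem_powerset.2 (hβ'.trans (Finset.subset_insert _ _)))
      have hc2 := hcard (insert e₀ β) (Finset.mem_powerset.2 (Finset.insert_subset_insert _ hβ'))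
      have hemp : insert e₀ β = {e₀} ↔ β = ∅ := by
        constructor
        · intro h
          have := congrArg (fun s => Finset.erase s e₀) h
          simpa [erase_insert hn] using this
        · rintro rfl; rfl
      rw [card_insert_of_notMem hn] at hc2
      rw [h1, h2, card_insert_of_notMem hn2]
      have hsp : signProd l (insert e₀ (α' \ β)) = edgeSign l e₀ * signProd l (α' \ β) :=
        Finset.prod_insert hn2
      rw [hsp]
      simp only [certCoeff, if_pos hc1, if_neg hn, Finset.mem_insert_self, if_true,
        hemp, card_insert_of_notMem hn, erase_insert hn, if_pos hc2]
      split_ifs with hb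
      · subst hb; simp; ring
      · ring
    rw [Finset.sum_congr rfl hterm, Finset.sum_ite_eq' , if_pos (empty_mem_powerset _)]
    have hsp : signProd l (insert e₀ α') = edgeSign l e₀ * signProd l α' := Finset.prod_insert h₀'
    rw [hsp, card_insert_of_notMem h₀']
    have : edgeSign l e₀ * edgeSign l e₀ = 1 := table_mul_self _ _
    linear_combination (-(lam ^ 2 * (lam ^ α'.card * signProd l α'))) * this
  · have hL : ∀ (l : Fin n → Label d) (β) (_ : β ∈ α.powerset), certCoeff d lam D e₀ l β *
        (lam ^ (α \ β).card * signProd l (α \ β)) =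
        lam ^ (α.card + 1) * cumulant d e₀ β * signProd l (α \ β) := by
      intro l β hβ
      have hβ' := Finset.mem_powerset.1 hβ
      have hn : e₀ ∉ β := fun h => h₀ (hβ' h)
      simp only [certCoeff, if_pos (hcard β hβ), if_neg hn]
      have : α.card = β.card + (α \ β).card := by
        rw [card_sdiff_of_subset hβ']; have := Finset.card_le_card hβ'; omega
      rw [this]; ring
    simp only [fun l => Finset.sum_congr rfl (hL l)]
    rw [expect_sum_comm]
    have hR : ∀ l : Fin n → Label d, lam * edgeSign l e₀ * (lam ^ α.card * signProd l α) =
        lam ^ (α.card + 1) * signProd l (insert e₀ α) := by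
      intro l
      rw [signProd, signProd, Finset.prod_insert h₀]; ring
    simp only [hR, ← mul_expect]
    have := sum_cumulant (d := d) e₀ α
    unfold moment at this
    rw [← this, Finset.mul_sum]
    exact Finset.sum_congr rfl fun β _ => by ring

/-- The weight of the certificate. -/
lemma sum_certCoeff_sq_le {lam u p : ℝ} {D : ℕ} (e₀ : Pairs n) (l : Fin n → Label d)
    (hu : 0 ≤ u) (hn : ((4 : ℝ) ^ d) ^ 3 ≤ n)
    (hη : u * lam ^ 2 = p * 4 ^ d / (n * (D : ℝ) ^ 4)) (hp : 0 ≤ p) (hp' : p ≤ 1 / 160)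
    (hlam : u * lam ^ 2 ≤ 1 / 10) :
    ∑ β, certCoeff d lam D e₀ l β ^ 2 * u ^ β.card ≤ lam ^ 2 / 2 := by
  have hS := sum_cumulant_sq_le (d := d) e₀ (D := D) hn hp hp'
  rw [← hη] at hS
  set U := (Finset.univ : Finset (Pairs n)).erase e₀
  have hU : e₀ ∉ U := notMem_erase _ _
  have huniv : (Finset.univ : Finset (Finset (Pairs n))) = (insert e₀ U).powerset := by
    rw [insert_erase (Finset.mem_univ _)]; ext; simp
  have hfil : (Finset.univ : Finset (Finset (Pairs n))).filter (fun β => e₀ ∉ β ∧ β.card ≤ D) =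
      U.powerset.filter (fun β => β.card ≤ D) := by
    ext β
    simp only [mem_filter, Finset.mem_univ, true_and, Finset.mem_powerset]
    have : β ⊆ U ↔ e₀ ∉ β := by
      constructor
      · exact fun h h' => hU (h h')
      · exact fun h e he => mem_erase.2 ⟨fun h' => h (h' ▸ he), Finset.mem_univ _⟩
    rw [this]
  rw [hfil, Finset.sum_filter] at hS
  rw [huniv, sum_powerset_insert hU, ← Finset.sum_add_distrib]
  have hes : edgeSign l e₀ ^ 2 = 1 := by rw [sq]; exact table_mul_self _ _
  -- Adding `e₀` to a nonempty `β` costs at most one factor `u * lam ^ 2`. At `β = ∅` the cumulant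
  -- vanishes and only the extra coefficient `lam ^ 2` of `{e₀}` remains.
  have hterm : ∀ β ∈ U.powerset, certCoeff d lam D e₀ l β ^ 2 * u ^ β.card +
      certCoeff d lam D e₀ l (insert e₀ β) ^ 2 * u ^ (insert e₀ β).card ≤
      (1 + u * lam ^ 2) * lam ^ 2 *
        (if β.card ≤ D then cumulant d e₀ β ^ 2 * (u * lam ^ 2) ^ β.card else 0) +
      if β = ∅ then u * lam ^ 4 else 0 := by
    intro β hβ
    have hn : e₀ ∉ β := fun h => hU (Finset.mem_powerset.1 hβ h)
    have hemp : insert e₀ β = {e₀} ↔ β = ∅ := by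
      constructor
      · intro h
        have := congrArg (fun s => Finset.erase s e₀) h
        simpa [erase_insert hn] using this
      · rintro rfl; rfl
    have hnon : 0 ≤ cumulant d e₀ β ^ 2 * (u * lam ^ 2) ^ β.card := by positivity
    have hnon1 : (0 : ℝ) ≤ if β = ∅ then u * lam ^ 4 else 0 := by positivity
    have h1 : certCoeff d lam D e₀ l β ^ 2 * u ^ β.card =
        lam ^ 2 * (if β.card ≤ D then cumulant d e₀ β ^ 2 * (u * lam ^ 2) ^ β.card else 0) := by
      simp only [certCoeff, if_neg hn]
      split_ifs
      · ring
      · simp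
    have h2 : certCoeff d lam D e₀ l (insert e₀ β) ^ 2 * u ^ (insert e₀ β).card ≤
        u * lam ^ 2 * lam ^ 2 *
          (if β.card ≤ D then cumulant d e₀ β ^ 2 * (u * lam ^ 2) ^ β.card else 0) +
        if β = ∅ then u * lam ^ 4 else 0 := by
      simp only [certCoeff, Finset.mem_insert_self, if_true, hemp, card_insert_of_notMem hn,
        erase_insert hn]
      by_cases hb : β = ∅
      · subst hb
        simp only [cumulant_empty, if_true]
        by_cases hD : #(∅ : Finset (Pairs n)) + 1 ≤ D
        · rw [if_pos hD]
          apply le_of_eq; simp; ring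
        · rw [if_neg hD]
          have : 0 ≤ u * lam ^ 4 := by positivity
          simpa using this
      · simp only [if_neg hb]
        by_cases hD : β.card + 1 ≤ D
        · rw [if_pos hD, if_pos (by omega)]
          apply le_of_eq
          rw [zero_sub, neg_sq, mul_pow, mul_pow, hes]
          ring
        · rw [if_neg hD]
          have : 0 ≤ u * lam ^ 2 * lam ^ 2 *
            (if β.card ≤ D then cumulant d e₀ β ^ 2 * (u * lam ^ 2) ^ β.card else 0) := by
            split_ifs
            · positivity
            · simp
          simpa using this
    rw [h1]
    linarith
  refine (Finset.sum_le_sum hterm).trans ?_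
  rw [Finset.sum_add_distrib, ← Finset.mul_sum, Finset.sum_ite_eq', if_pos (empty_mem_powerset _)]
  have hl2 : 0 ≤ lam ^ 2 := sq_nonneg _
  have hul : 0 ≤ u * lam ^ 2 := by positivity
  calc _ ≤ (1 + u * lam ^ 2) * lam ^ 2 * (1 / 4) + u * lam ^ 4 := by gcongr
    _ = lam ^ 2 * ((1 + u * lam ^ 2) / 4 + u * lam ^ 2) := by ring
    _ ≤ lam ^ 2 * (1 / 2) := by gcongr; linarith
    _ = _ := by ring

/-- A low degree estimator of the mean of the edge `e₀` has large mean squared error. -/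
theorem le_expect_sq_error {lam u p η : ℝ} {D : ℕ} (e₀ : Pairs n)
    (hn : ((4 : ℝ) ^ d) ^ 3 ≤ n)
    (hη : u * lam ^ 2 = η * 4 ^ d / (n * (D : ℝ) ^ 4)) (hη0 : 0 ≤ η) (hη1 : η ≤ 1 / 160)
    (hlam : u * lam ^ 2 ≤ 1 / 10) (hu : 0 < u)
    (hvar : ∀ s : ℝ, |s| = 1 → 0 < p + lam * s ∧ p + lam * s < 1 ∧
      1 / ((p + lam * s) * (1 - (p + lam * s))) ≤ u)
    {g : (Pairs n → Bool) → ℝ} (hg : g ∈ lowDegree (Pairs n) D) :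
    lam ^ 2 / 2 ≤ 𝔼 l : Fin n → Label d,
      bernExp (fun e => p + lam * edgeSign l e)
        (fun a => (g a - (p + lam * edgeSign l e₀)) ^ 2) := by
  set M : (Fin n → Label d) → Pairs n → ℝ := fun l e => p + lam * edgeSign l e with hM
  have hMv : ∀ l e, 0 < M l e ∧ M l e < 1 ∧ 1 / (M l e * (1 - M l e)) ≤ u := fun l e =>
    hvar _ (abs_table _ _)
  have h0 : ∀ l e, M l e ≠ 0 := fun l e => (hMv l e).1.ne'
  have h1 : ∀ l e, 1 - M l e ≠ 0 := fun l e => (sub_pos.2 (hMv l e).2.1).ne'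
  have hI : ∀ l e, M l e ∈ Set.Icc (0 : ℝ) 1 := fun l e => ⟨(hMv l e).1.le, (hMv l e).2.1.le⟩
  set h : (Fin n → Label d) → (Pairs n → Bool) → ℝ := fun l a =>
    ∑ β, certCoeff d lam D e₀ l β * residual (M l) β a with hh
  -- Averaged over labels and edges, `h` has the same correlations with low degree functions as the
  -- centred target. By linearity it is enough to test the monomials centred at `p`.
  have horth : ∀ g ∈ lowDegree (Pairs n) D,
      𝔼 l : Fin n → Label d, bernExp (M l) (fun a => g a * (h l a - lam * edgeSign l e₀)) = 0 := by
    intro g hg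
    let Φ : ((Pairs n → Bool) → ℝ) →ₗ[ℝ] ℝ :=
      { toFun := fun g => 𝔼 l : Fin n → Label d,
          bernExp (M l) (fun a => g a * (h l a - lam * edgeSign l e₀))
        map_add' := by
          intro g g'
          rw [← expect_add_distrib]
          refine Finset.expect_congr rfl fun l _ => ?_
          rw [← map_add]
          congr 1
          ext a
          simp only [Pi.add_apply]; ring
        map_smul' := by
          intro c g
          rw [RingHom.id_apply, smul_eq_mul, mul_expect]
          refine Finset.expect_congr rfl fun l _ => ?_
          have := (bernExp (M l)).map_smul c (fun a => g a * (h l a - lam * edgeSign l e₀))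
          rw [smul_eq_mul] at this
          rw [← this]
          congr 1
          ext a
          simp only [Pi.smul_apply, smul_eq_mul]; ring }
    refine eq_zero_of_lowDegree p Φ ?_ hg
    intro α hα
    change 𝔼 l : Fin n → Label d,
      bernExp (M l) (fun a => centred p α a * (h l a - lam * edgeSign l e₀)) = 0
    have hsplit : ∀ l, bernExp (M l) (fun a => centred p α a * (h l a - lam * edgeSign l e₀)) =
        ∑ β ∈ α.powerset, certCoeff d lam D e₀ l β * ∏ e ∈ α \ β, lam * edgeSign l e -
          lam * edgeSign l e₀ * ∏ e ∈ α, lam * edgeSign l e := by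
      intro l
      have e1 : (fun a => centred p α a * (h l a - lam * edgeSign l e₀)) =
          (fun a => centred p α a * h l a) -
            (lam * edgeSign l e₀) • fun a => centred p α a * residual (M l) ∅ a := by
        ext a
        simp only [Pi.sub_apply, Pi.smul_apply, smul_eq_mul, residual, Finset.prod_empty]; ring
      rw [e1, map_sub, map_smul, bernExp_centred_mul_sum (h0 l) (h1 l),
        bernExp_centred_mul_residual (h0 l) (h1 l)]
      simp [hM]
    simp only [hsplit]
    rw [expect_sub_distrib, sum_certCoeff hα, sub_self]
  have hconst : (fun _ => p : (Pairs n → Bool) → ℝ) ∈ lowDegree (Pairs n) D := by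
    have : (fun _ => p : (Pairs n → Bool) → ℝ) =
        p • fun a => ∏ e ∈ (∅ : Finset (Pairs n)), ind (a e) := by
      ext a; simp
    rw [this]
    exact Submodule.smul_mem _ _ (Submodule.subset_span ⟨∅, by simp, rfl⟩)
  have hgp : 𝔼 l : Fin n → Label d,
      bernExp (M l) (fun a => (g a - p) * (h l a - lam * edgeSign l e₀)) = 0 :=
    horth _ (Submodule.sub_mem _ hg hconst)
  have hsq : ∀ l : Fin n → Label d, edgeSign l e₀ ^ 2 = 1 := by
    intro l; rw [sq]; exact table_mul_self _ _
  have hone : ∀ l, bernExp (M l) (fun _ => 1) = 1 := by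
    intro l
    have := bernExp_prod (M l) (fun _ _ => 1)
    simpa using this
  have hlow : ∀ l, lam ^ 2 / 2 + 2 * bernExp (M l)
      (fun a => (g a - p) * (h l a - lam * edgeSign l e₀)) ≤
      bernExp (M l) (fun a => (g a - M l e₀) ^ 2) := by
    intro l
    -- Completing the square around `h`, using that the sign squares to one. The cross term vanishes
    -- only after averaging over `l`, whereas the bound on `E h²` holds for each `l`.
    have e1 : (fun a => (g a - M l e₀) ^ 2) =
        (fun a => (g a - p - h l a) ^ 2) +
          (2 : ℝ) • (fun a => (g a - p) * (h l a - lam * edgeSign l e₀)) +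
          lam ^ 2 • (fun _ => (1 : ℝ)) - fun a => (h l a) ^ 2 := by
      ext a
      simp only [hM, Pi.sub_apply, Pi.add_apply, Pi.smul_apply, smul_eq_mul]
      linear_combination lam ^ 2 * hsq l
    rw [e1, map_sub, map_add, map_add, map_smul, map_smul, hone, smul_eq_mul, smul_eq_mul]
    have e2 : 0 ≤ bernExp (M l) (fun a => (g a - p - h l a) ^ 2) :=
      bernExp_nonneg (hI l) fun a => sq_nonneg _
    have e3 : bernExp (M l) (fun a => (h l a) ^ 2) ≤ lam ^ 2 / 2 := by
      simp only [hh]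
      rw [bernExp_sum_sq (h0 l) (h1 l)]
      refine le_trans ?_ (sum_certCoeff_sq_le (d := d) e₀ l hu.le hn hη hη0 hη1 hlam)
      refine Finset.sum_le_sum fun β _ => ?_
      refine mul_le_mul_of_nonneg_left ?_ (sq_nonneg _)
      rw [← prod_const]
      refine Finset.prod_le_prod (fun e _ => ?_) fun e _ => (hMv l e).2.2
      have := (hMv l e).1
      have := sub_pos.2 (hMv l e).2.1
      positivity
    linarith
  have hfin := Finset.expect_le_expect (s := Finset.univ) fun l _ => hlow l
  rw [expect_add_distrib, ← mul_expect, hgp, mul_zero, add_zero, Fintype.expect_const] at hfin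
  exact hfin

end Certificate

/-! ### From polynomial estimators and discrete latent laws to the risk. -/

lemma adjacency_self (a : Pairs n → Bool) (i : Fin n) : adjacency a i i = 0 := by
  simp [adjacency]

lemma exists_adjacency_eq_ind {i j : Fin n} (h : i ≠ j) :
    ∃ e : Pairs n, ∀ a : Pairs n → Bool, adjacency a i j = ind (a e) := by
  rcases lt_or_gt_of_ne h with h | h
  · exact ⟨⟨(i, j), h⟩, fun a => by simp [adjacency, h, ind]⟩
  · exact ⟨⟨(j, i), h⟩, fun a => by simp [adjacency, h, h.not_gt, ind]⟩

lemma ind_pow (b : Bool) {k : ℕ} (hk : k ≠ 0) : ind b ^ k = ind b := by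
  cases b <;> simp [ind, hk]

lemma ind_mul_prod_ind {E : Type*} [DecidableEq E] (a : E → Bool) (e : E) (α : Finset E) :
    ind (a e) * ∏ x ∈ α, ind (a x) = ∏ x ∈ insert e α, ind (a x) := by
  by_cases h : e ∈ α
  · rw [Finset.insert_eq_of_mem h, ← mul_prod_erase α _ h, ← mul_assoc, ← sq, ind_pow _ two_ne_zero]
  · rw [Finset.prod_insert h]

/-- Diagonal entries vanish, powers of indicators collapse, and the entries `(i, j)` and `(j, i)`
give the same edge, so a monomial becomes zero or multilinear without gaining degree. -/
lemma prod_adjacency_eq (s : Finset (Fin n × Fin n)) (k : Fin n × Fin n → ℕ)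
    (hk : ∀ q ∈ s, k q ≠ 0) :
    (∀ a : Pairs n → Bool, ∏ q ∈ s, adjacency a q.1 q.2 ^ k q = 0) ∨
      ∃ α : Finset (Pairs n), α.card ≤ s.card ∧
        ∀ a : Pairs n → Bool, ∏ q ∈ s, adjacency a q.1 q.2 ^ k q = ∏ e ∈ α, ind (a e) := by
  classical
  induction s using Finset.induction_on with
  | empty => exact Or.inr ⟨∅, by simp, by simp⟩
  | insert q s hq ih =>
    have hkq := hk q (Finset.mem_insert_self _ _)
    by_cases hqq : q.1 = q.2
    · refine Or.inl fun a => ?_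
      rw [Finset.prod_insert hq, hqq, adjacency_self, zero_pow hkq, zero_mul]
    · obtain ⟨e, he⟩ := exists_adjacency_eq_ind hqq
      rcases ih fun q hq => hk q (Finset.mem_insert_of_mem hq) with h | ⟨α, hα, h⟩
      · exact Or.inl fun a => by rw [Finset.prod_insert hq, h, mul_zero]
      · refine Or.inr ⟨insert e α, ?_, fun a => ?_⟩
        · rw [card_insert_of_notMem hq]
          exact (card_insert_le _ _).trans (by omega)
        · rw [Finset.prod_insert hq, h, he, ind_pow _ hkq, ind_mul_prod_ind]

lemma eval_adjacency_mem_lowDegree {D : ℕ} (q : MvPolynomial (Fin n × Fin n) ℝ)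
    (hq : q.totalDegree ≤ D) :
    (fun a : Pairs n → Bool => MvPolynomial.eval (fun z => adjacency a z.1 z.2) q) ∈
      lowDegree (Pairs n) D := by
  have : (fun a : Pairs n → Bool => MvPolynomial.eval (fun z => adjacency a z.1 z.2) q) =
      ∑ s ∈ q.support, q.coeff s • fun a => ∏ z ∈ s.support, adjacency a z.1 z.2 ^ s z := by
    ext a
    simp [MvPolynomial.eval_eq, Finset.sum_apply]
  rw [this]
  refine Submodule.sum_mem _ fun s hs => Submodule.smul_mem _ _ ?_
  rcases prod_adjacency_eq (n := n) s.support s (fun q hq => Finsupp.mem_support_iff.1 hq) with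
    h | ⟨α, hα, h⟩
  · rw [funext h]; exact Submodule.zero_mem _
  · rw [funext h]
    refine Submodule.subset_span ⟨α, hα.trans ?_, rfl⟩
    have h1 := (MvPolynomial.le_totalDegree hs).trans hq
    refine le_trans ?_ h1
    rw [Finsupp.sum, card_eq_sum_ones]
    exact Finset.sum_le_sum fun z hz => Nat.one_le_iff_ne_zero.2 (Finsupp.mem_support_iff.1 hz)

lemma choose_two_le_card_pairs (n : ℕ) : n.choose 2 ≤ Fintype.card (Pairs n) := by
  have h : powersetCard 2 (Finset.univ : Finset (Fin n)) ⊆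
      (Finset.univ : Finset (Pairs n)).image ends := by
    intro s hs
    obtain ⟨x, y, hxy, rfl⟩ := card_eq_two.1 (Finset.mem_powersetCard.1 hs).2
    rcases lt_or_gt_of_ne hxy with h | h
    · exact Finset.mem_image.2 ⟨⟨(x, y), h⟩, Finset.mem_univ _, rfl⟩
    · exact Finset.mem_image.2 ⟨⟨(y, x), h⟩, Finset.mem_univ _, Finset.pair_comm _ _⟩
  calc n.choose 2 = (powersetCard 2 (Finset.univ : Finset (Fin n))).card := by simp
    _ ≤ _ := (Finset.card_le_card h).trans card_image_le

/-- The uniform distribution on the points `pts x`. -/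
def uniformLaw {Λ : Type*} [Fintype Λ] [Nonempty Λ] (pts : Λ → I) : ProbabilityMeasure I :=
  letI : MeasurableSpace Λ := ⊤
  ⟨(PMF.uniformOfFintype Λ).toMeasure.map pts,
    Measure.isProbabilityMeasure_map measurable_from_top.aemeasurable⟩

lemma lintegral_pi_uniformLaw {Λ : Type*} [Fintype Λ] [Nonempty Λ] (pts : Λ → I)
    {F : (Fin n → I) → ℝ≥0∞} (hF : Measurable F) :
    ∫⁻ ξ, F ξ ∂(Measure.pi fun _ : Fin n => (uniformLaw pts : Measure I)) =
      ∑ l : Fin n → Λ, F (fun i => pts (l i)) * (Fintype.card (Fin n → Λ) : ℝ≥0∞)⁻¹ := by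
  classical
  let _ : MeasurableSpace Λ := ⊤
  have hpts : Measurable pts := measurable_from_top
  set μ := (PMF.uniformOfFintype Λ).toMeasure with hμ
  have h1 : (Measure.pi fun _ : Fin n => (uniformLaw pts : Measure I)) =
      (Measure.pi fun _ : Fin n => μ).map (fun l i => pts (l i)) := by
    rw [Measure.pi_map_pi fun _ => hpts.aemeasurable]
    rfl
  have hmeas : Measurable fun (l : Fin n → Λ) (i : Fin n) => pts (l i) :=
    measurable_pi_lambda _ fun i => hpts.comp (measurable_pi_apply i)
  rw [h1, lintegral_map hF hmeas, lintegral_fintype]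
  refine Finset.sum_congr rfl fun l _ => ?_
  congr 1
  rw [Measure.pi_singleton]
  simp only [hμ, PMF.toMeasure_apply_singleton _ _ (measurableSet_singleton _),
    PMF.uniformOfFintype_apply, prod_const, card_univ, Fintype.card_fin, Fintype.card_fun]
  rw [Nat.cast_pow, ENNReal.inv_pow]

lemma measurable_edgeProb {f : ℝ × ℝ → ℝ} (hf : Continuous f) (e : Pairs n) :
    Measurable fun ξ : Fin n → I => edgeProb f ξ e := by
  apply Continuous.measurable
  unfold edgeProb
  fun_prop

lemma measurable_risk_integrand {f : ℝ × ℝ → ℝ} (hf : Continuous f) (Mhat : PolyEstimator n) :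
    Measurable fun ξ : Fin n → I => ∑ a : Pairs n → Bool,
      ENNReal.ofReal (graphProb f ξ a * loss Mhat f ξ a) := by
  refine Finset.measurable_sum _ fun a _ => ENNReal.measurable_ofReal.comp (Measurable.mul ?_ ?_)
  · refine Finset.measurable_prod _ fun e _ => ?_
    split_ifs
    · exact measurable_edgeProb hf e
    · exact measurable_const.sub (measurable_edgeProb hf e)
  · refine measurable_const.mul (Finset.measurable_sum _ fun e _ => ?_)
    exact (measurable_const.sub (measurable_edgeProb hf e)).pow_const 2

/-- A graphon interpolating the sign table is hard to estimate for low degree polynomials. -/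
theorem le_risk {lam u p η : ℝ} {D : ℕ} (hn2 : 2 ≤ n)
    (hn : ((4 : ℝ) ^ d) ^ 3 ≤ n)
    (hη : u * lam ^ 2 = η * 4 ^ d / (n * (D : ℝ) ^ 4)) (hη0 : 0 ≤ η) (hη1 : η ≤ 1 / 160)
    (hlam : u * lam ^ 2 ≤ 1 / 10) (hu : 0 < u)
    (hvar : ∀ s : ℝ, |s| = 1 → 0 < p + lam * s ∧ p + lam * s < 1 ∧
      1 / ((p + lam * s) * (1 - (p + lam * s))) ≤ u)
    {f : ℝ × ℝ → ℝ} (hf : Continuous f) (pts : Label d → I)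
    (hpts : ∀ x y, f ((pts x : ℝ), (pts y : ℝ)) = p + lam * table x y)
    (Mhat : PolyEstimator n) (hM : ∀ e, (Mhat e).totalDegree ≤ D) :
    ENNReal.ofReal (lam ^ 2 / 2) ≤ risk Mhat f (uniformLaw pts) := by
  classical
  rw [risk, lintegral_pi_uniformLaw pts (measurable_risk_integrand hf Mhat)]
  set M : (Fin n → Label d) → Pairs n → ℝ := fun l e => p + lam * edgeSign l e with hMdef
  set g : Pairs n → (Pairs n → Bool) → ℝ := fun e a =>
    MvPolynomial.eval (fun z => adjacency a z.1 z.2) (Mhat e) with hg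
  have hedge : ∀ (l : Fin n → Label d) e, edgeProb f (fun i => pts (l i)) e = M l e :=
    fun l e => hpts _ _
  have hI : ∀ l e, M l e ∈ Set.Icc (0 : ℝ) 1 := fun l e =>
    have := hvar _ (abs_table (l e.1.1) (l e.1.2))
    ⟨this.1.le, this.2.1.le⟩
  have hgraph : ∀ (l : Fin n → Label d) a,
      graphProb f (fun i => pts (l i)) a = bernWeight (M l) a := by
    intro l a
    simp only [graphProb, bernWeight, hedge]
  have hchoose : 0 < (n.choose 2 : ℝ) := by exact_mod_cast Nat.choose_pos hn2
  have hloss : ∀ (l : Fin n → Label d) a, loss Mhat f (fun i => pts (l i)) a =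
      (1 / (n.choose 2 : ℝ)) * ∑ e, (g e a - M l e) ^ 2 := by
    intro l a
    simp only [loss, hedge, hg]
  have hterm : ∀ l : Fin n → Label d, ∑ a : Pairs n → Bool, ENNReal.ofReal
      (graphProb f (fun i => pts (l i)) a * loss Mhat f (fun i => pts (l i)) a) =
      ENNReal.ofReal ((1 / (n.choose 2 : ℝ)) *
        ∑ e, bernExp (M l) (fun a => (g e a - M l e) ^ 2)) := by
    intro l
    simp only [hgraph, hloss]
    rw [← ENNReal.ofReal_sum_of_nonneg]
    · congr 1
      simp only [bernExp_apply]
      rw [Finset.sum_comm, Finset.mul_sum]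
      refine Finset.sum_congr rfl fun a _ => ?_
      rw [← Finset.mul_sum]; ring
    · intro a _
      exact mul_nonneg (bernWeight_nonneg (hI l) a) (mul_nonneg (by positivity)
        (Finset.sum_nonneg fun e _ => sq_nonneg _))
  simp only [hterm]
  rw [← Finset.sum_mul, ← ENNReal.ofReal_sum_of_nonneg]
  swap
  · intro l _
    exact mul_nonneg (by positivity) (Finset.sum_nonneg fun e _ =>
      bernExp_nonneg (hI l) fun a => sq_nonneg _)
  have hK : 0 < (Fintype.card (Fin n → Label d) : ℝ) := by exact_mod_cast Fintype.card_pos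
  rw [← ENNReal.ofReal_natCast, ← ENNReal.ofReal_inv_of_pos hK, ← ENNReal.ofReal_mul']
  swap
  · positivity
  apply ENNReal.ofReal_le_ofReal
  rw [← div_eq_mul_inv, ← Fintype.expect_eq_sum_div_card, ← mul_expect, expect_sum_comm]
  have hmain : ∀ e ∈ (Finset.univ : Finset (Pairs n)), lam ^ 2 / 2 ≤
      𝔼 l : Fin n → Label d, bernExp (M l) (fun a => (g e a - M l e) ^ 2) := fun e _ =>
    le_expect_sq_error e hn hη hη0 hη1 hlam hu hvar (eval_adjacency_mem_lowDegree _ (hM e))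
  have hsum := Finset.card_nsmul_le_sum _ _ _ hmain
  rw [nsmul_eq_mul, card_univ] at hsum
  have hcard : (n.choose 2 : ℝ) ≤ Fintype.card (Pairs n) := by
    exact_mod_cast choose_two_le_card_pairs n
  rw [one_div, ← div_eq_inv_mul, le_div_iff₀ hchoose, mul_comm]
  refine le_trans ?_ hsum
  gcongr

end Graphon

end

noncomputable section

namespace Graphon

/-! ### Hölder norms from explicit partial derivatives. -/

section Derivatives

/-- A doubly indexed family of functions on the plane, each the corresponding mixed partial
derivative of the first one. -/
def IsDerivFamily (g : ℕ → ℕ → ℝ × ℝ → ℝ) : Prop :=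
  ∀ j k z, HasFDerivAt (g j k) (g (j + 1) k z • ContinuousLinearMap.fst ℝ ℝ ℝ +
    g j (k + 1) z • ContinuousLinearMap.snd ℝ ℝ ℝ) z

lemma IsDerivFamily.contDiff {g : ℕ → ℕ → ℝ × ℝ → ℝ} (hg : IsDerivFamily g) (m : ℕ) :
    ∀ j k, ContDiff ℝ m (g j k) := by
  induction m with
  | zero =>
    intro j k
    exact contDiff_zero.2 (continuous_iff_continuousAt.2 fun z => (hg j k z).continuousAt)
  | succ m ih =>
    intro j k
    push_cast
    exact contDiff_succ_iff_hasFDerivAt.2 ⟨_, ((ih _ _).smul contDiff_const).add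
      ((ih _ _).smul contDiff_const), hg j k⟩

lemma IsDerivFamily.iteratedFDeriv_apply {g : ℕ → ℕ → ℝ × ℝ → ℝ} (hg : IsDerivFamily g) (m : ℕ) :
    ∀ j k, j + k = m → ∀ z, iteratedFDeriv ℝ m (g 0 0) z
      (fun i : Fin m => if (i : ℕ) < j then ((1 : ℝ), (0 : ℝ)) else ((0 : ℝ), (1 : ℝ))) =
        g j k z := by
  induction m with
  | zero =>
    intro j k h z
    obtain ⟨rfl, rfl⟩ : j = 0 ∧ k = 0 := by omega
    simp
  | succ m ih =>
    intro j k h z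
    have hd : DifferentiableAt ℝ (iteratedFDeriv ℝ m (g 0 0)) z :=
      ((hg.contDiff (m + 1) 0 0).differentiable_iteratedFDeriv
        (by exact_mod_cast Nat.lt_succ_self m)) z
    rw [iteratedFDeriv_succ_apply_left, ← fderiv_continuousMultilinear_apply_const_apply hd]
    rcases j with _ | j
    · obtain ⟨k, rfl⟩ : ∃ k', k = k' + 1 := ⟨k - 1, by omega⟩
      have htail : (fun y => iteratedFDeriv ℝ m (g 0 0) y
          (Fin.tail fun i : Fin (m + 1) =>
            if (i : ℕ) < 0 then ((1 : ℝ), (0 : ℝ)) else ((0 : ℝ), (1 : ℝ)))) = g 0 k := by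
        ext y
        rw [← ih 0 k (by omega) y]
        congr 1
      rw [htail, (hg 0 k z).fderiv]
      simp
    · have htail : (fun y => iteratedFDeriv ℝ m (g 0 0) y
          (Fin.tail fun i : Fin (m + 1) =>
            if (i : ℕ) < j + 1 then ((1 : ℝ), (0 : ℝ)) else ((0 : ℝ), (1 : ℝ)))) = g j k := by
        ext y
        rw [← ih j k (by omega) y]
        congr 1
        ext1 i
        simp [Fin.tail]
      rw [htail, (hg j k z).fderiv]
      simp

lemma convex_triangle : Convex ℝ triangle := by
  rintro ⟨x, y⟩ ⟨⟨hx0, hx1⟩, ⟨hy0, hy1⟩, hxy⟩ ⟨x', y'⟩ ⟨⟨hx0', hx1'⟩, ⟨hy0', hy1'⟩, hxy'⟩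
    a b ha hb hab
  simp only [triangle, mem_ofPred_eq, mem_Icc, Prod.smul_mk, Prod.mk_add_mk, smul_eq_mul] at *
  refine ⟨⟨by positivity, ?_⟩, ⟨by positivity, ?_⟩, ?_⟩ <;> nlinarith

lemma uniqueDiffOn_triangle : UniqueDiffOn ℝ triangle := by
  refine uniqueDiffOn_convex convex_triangle ⟨(3 / 4, 1 / 4), ?_⟩
  rw [mem_interior]
  refine ⟨{z | 0 < z.2 ∧ z.2 < z.1 ∧ z.1 < 1}, ?_, ?_, ?_⟩
  · rintro ⟨x, y⟩ ⟨h1, h2, h3⟩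
    simp only at h1 h2 h3
    exact ⟨⟨by linarith, h3.le⟩, ⟨h1.le, by linarith⟩, h2.le⟩
  · exact (isOpen_lt continuous_const continuous_snd).inter
      ((isOpen_lt continuous_snd continuous_fst).inter (isOpen_lt continuous_fst continuous_const))
  · norm_num

lemma IsDerivFamily.pderiv_eq {g : ℕ → ℕ → ℝ × ℝ → ℝ} (hg : IsDerivFamily g) (j k : ℕ)
    {z : ℝ × ℝ} (hz : z ∈ triangle) : pderiv j k (g 0 0) z = g j k z := by
  rw [pderiv, iteratedFDerivWithin_eq_iteratedFDeriv uniqueDiffOn_triangle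
    (hg.contDiff (j + k) 0 0).contDiffAt hz]
  exact hg.iteratedFDeriv_apply _ j k rfl z

/-- A function whose mixed partial derivatives grow at most geometrically has controlled Hölder
norms. -/
lemma IsDerivFamily.holderNorm_le {g : ℕ → ℕ → ℝ × ℝ → ℝ} (hg : IsDerivFamily g)
    {γ lam B p : ℝ} (hγ : 0 ≤ γ) (hlam : 0 ≤ lam) (hB : 1 ≤ B) (hp : 0 ≤ p)
    (h0 : ∀ z, |g 0 0 z - p| ≤ lam) (hbd : ∀ j k z, 0 < j + k → |g j k z| ≤ lam * B ^ (j + k)) :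
    holderNorm γ (g 0 0) ≤ ENNReal.ofReal (p + 3 * (lam * B ^ γ)) := by
  have hB0 : 0 < B := by linarith
  have hpow : ∀ m : ℕ, m ≤ ⌊γ⌋₊ → B ^ m ≤ B ^ γ := by
    intro m hm
    rw [← Real.rpow_natCast]
    exact Real.rpow_le_rpow_of_exponent_le hB ((Nat.cast_le.2 hm).trans (Nat.floor_le hγ))
  have hBγ : 1 ≤ B ^ γ := Real.one_le_rpow hB hγ
  -- One `lam * B ^ γ` is for the derivatives and two are for the Hölder quotient; `p` enters only
  -- at order zero.
  have hsplit : ENNReal.ofReal (p + 3 * (lam * B ^ γ)) =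
      ENNReal.ofReal (p + lam * B ^ γ) + ENNReal.ofReal (2 * (lam * B ^ γ)) := by
    rw [← ENNReal.ofReal_add (by positivity) (by positivity)]
    congr 1; ring
  rw [hsplit, holderNorm]
  refine add_le_add ?_ ?_
  · refine iSup_le fun j => iSup_le fun k => iSup_le fun hjk => iSup_le fun z => iSup_le fun hz => ?_
    apply ENNReal.ofReal_le_ofReal
    rw [hg.pderiv_eq j k hz]
    rcases Nat.eq_zero_or_pos (j + k) with h | h
    · obtain ⟨rfl, rfl⟩ : j = 0 ∧ k = 0 := by omega
      have := abs_le.1 (h0 z)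
      rw [abs_le]
      constructor <;> nlinarith
    · have h1 := hbd j k z h
      have h2 := mul_le_mul_of_nonneg_left (hpow _ hjk) hlam
      linarith
  · refine iSup_le fun j => iSup_le fun k => iSup_le fun hjk => iSup_le fun z => iSup_le fun hz =>
      iSup_le fun w => iSup_le fun hw => iSup_le fun hne => ?_
    apply ENNReal.ofReal_le_ofReal
    rw [hg.pderiv_eq j k hz, hg.pderiv_eq j k hw]
    set t := |z.1 - w.1| + |z.2 - w.2| with ht
    have ht0 : 0 < t := by
      by_contra hcon
      have h1 := abs_nonneg (z.1 - w.1)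
      have h2 := abs_nonneg (z.2 - w.2)
      have h3 : |z.1 - w.1| = 0 := by linarith
      have h4 : |z.2 - w.2| = 0 := by linarith
      rw [abs_eq_zero, sub_eq_zero] at h3 h4
      exact hne (Prod.ext h3 h4)
    set m := j + k with hm
    have hlip : |g j k z - g j k w| ≤ lam * B ^ (m + 1) * t := by
      have hx : |g j k (z.1, z.2) - g j k (w.1, z.2)| ≤ lam * B ^ (m + 1) * |z.1 - w.1| := by
        have := Convex.norm_image_sub_le_of_norm_hasDerivWithin_le (𝕜 := ℝ)
          (f := fun x => g j k (x, z.2)) (f' := fun x => g (j + 1) k (x, z.2)) (s := univ)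
          (x := w.1) (y := z.1) (C := lam * B ^ (m + 1))
          (fun x _ => by
            have h : HasDerivAt (fun x => g j k (x, z.2)) _ x :=
              (hg j k (x, z.2)).comp_hasDerivAt x
                ((hasDerivAt_id x).prodMk (hasDerivAt_const x z.2))
            simpa using h)
          (fun x _ => by
            have := hbd (j + 1) k (x, z.2) (by omega)
            rwa [show j + 1 + k = m + 1 by omega] at this)
          convex_univ (mem_univ _) (mem_univ _)
        simpa using this
      have hy : |g j k (w.1, z.2) - g j k (w.1, w.2)| ≤ lam * B ^ (m + 1) * |z.2 - w.2| := by
        have := Convex.norm_image_sub_le_of_norm_hasDerivWithin_le (𝕜 := ℝ)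
          (f := fun y => g j k (w.1, y)) (f' := fun y => g j (k + 1) (w.1, y)) (s := univ)
          (x := w.2) (y := z.2) (C := lam * B ^ (m + 1))
          (fun y _ => by
            have h : HasDerivAt (fun y => g j k (w.1, y)) _ y :=
              (hg j k (w.1, y)).comp_hasDerivAt y
                ((hasDerivAt_const y w.1).prodMk (hasDerivAt_id y))
            simpa using h)
          (fun y _ => by
            have := hbd j (k + 1) (w.1, y) (by omega)
            rwa [show j + (k + 1) = m + 1 by omega] at this)
          convex_univ (mem_univ _) (mem_univ _)
        simpa using this
      have h := abs_sub_le (g j k z) (g j k (w.1, z.2)) (g j k w)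
      rw [ht, mul_add]
      exact h.trans (add_le_add hx hy)
    have hosc : |g j k z - g j k w| ≤ lam * B ^ m * 2 := by
      rcases Nat.eq_zero_or_pos m with h | h
      · obtain ⟨rfl, rfl⟩ : j = 0 ∧ k = 0 := by omega
        have h1 := h0 z
        have h2 := h0 w
        rw [h]
        have h3 := abs_sub_le (g 0 0 z) p (g 0 0 w)
        rw [abs_sub_comm p] at h3
        simp only [pow_zero]; linarith
      · have h1 := hbd j k z h
        have h2 := hbd j k w h
        have h3 := abs_sub (g j k z) (g j k w)
        linarith
    have hθ0 : 0 ≤ γ - (⌊γ⌋₊ : ℝ) := sub_nonneg.2 (Nat.floor_le hγ)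
    have hθ1 : γ - (⌊γ⌋₊ : ℝ) ≤ 1 := by linarith [Nat.lt_floor_add_one γ]
    rw [div_le_iff₀ (Real.rpow_pos_of_pos ht0 _)]
    set θ := γ - (⌊γ⌋₊ : ℝ) with hθ
    have hBsplit : B ^ γ = B ^ m * B ^ θ := by
      rw [← Real.rpow_natCast, ← Real.rpow_add hB0, hjk]
      congr 1; rw [hθ]; ring
    -- Interpolates between the Lipschitz bound at distances below `1 / B` and the oscillation bound
    -- beyond.
    have hkey : |g j k z - g j k w| ≤ lam * B ^ m * (2 * (B * t) ^ θ) := by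
      have hs : 0 < B * t := by positivity
      have hlB : 0 ≤ lam * B ^ m := by positivity
      rcases le_total (B * t) 1 with h | h
      · have h1 : B * t ≤ (B * t) ^ θ := by
          simpa using Real.rpow_le_rpow_of_exponent_ge hs h hθ1
        calc |g j k z - g j k w| ≤ lam * B ^ (m + 1) * t := hlip
          _ = lam * B ^ m * (B * t) := by ring
          _ ≤ _ := mul_le_mul_of_nonneg_left (by linarith) hlB
      · have h1 : 1 ≤ (B * t) ^ θ := Real.one_le_rpow h hθ0
        exact hosc.trans (mul_le_mul_of_nonneg_left (by linarith) hlB)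
    refine hkey.trans (le_of_eq ?_)
    rw [hBsplit, Real.mul_rpow hB0.le ht0.le]; ring

end Derivatives

/-! ### Smooth graphons from tensor products. -/

section Interpolation

variable {ι : Type*} [Fintype ι]

/-- The perturbation of a constant by a combination of products of one-variable functions, with
its mixed partial derivatives. -/
def tensorFamily (p lam : ℝ) (T : ι → ι → ℝ) (u : ι → ℕ → ℝ → ℝ) (j k : ℕ) (z : ℝ × ℝ) : ℝ :=
  (if j + k = 0 then p else 0) + lam * ∑ a, ∑ b, T a b * (u a j z.1 * u b k z.2)

lemma isDerivFamily_tensorFamily (p lam : ℝ) (T : ι → ι → ℝ) {u : ι → ℕ → ℝ → ℝ}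
    (hu : ∀ a j x, HasDerivAt (u a j) (u a (j + 1) x) x) :
    IsDerivFamily (tensorFamily p lam T u) := by
  intro j k z
  have hterm : ∀ a b, HasFDerivAt (fun z : ℝ × ℝ => T a b * (u a j z.1 * u b k z.2))
      ((T a b * (u a (j + 1) z.1 * u b k z.2)) • ContinuousLinearMap.fst ℝ ℝ ℝ +
        (T a b * (u a j z.1 * u b (k + 1) z.2)) • ContinuousLinearMap.snd ℝ ℝ ℝ) z := by
    intro a b
    have h1 : HasFDerivAt (fun z : ℝ × ℝ => u a j z.1)
        (u a (j + 1) z.1 • ContinuousLinearMap.fst ℝ ℝ ℝ) z :=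
      (hu a j z.1).comp_hasFDerivAt z hasFDerivAt_fst
    have h2 : HasFDerivAt (fun z : ℝ × ℝ => u b k z.2)
        (u b (k + 1) z.2 • ContinuousLinearMap.snd ℝ ℝ ℝ) z :=
      (hu b k z.2).comp_hasFDerivAt z hasFDerivAt_snd
    refine ((h1.mul h2).const_mul (T a b)).congr_fderiv ?_
    ext <;> simp [mul_comm]
  have hsum := HasFDerivAt.fun_sum fun a (_ : a ∈ Finset.univ) =>
    HasFDerivAt.fun_sum fun b (_ : b ∈ Finset.univ) => hterm a b
  refine ((hsum.const_mul lam).const_add (if j + k = 0 then p else 0)).congr_fderiv ?_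
  have e1 : ¬ (j + 1 + k = 0) := by omega
  have e2 : ¬ (j + (k + 1) = 0) := by omega
  simp only [tensorFamily, if_neg e1, if_neg e2, zero_add, Finset.sum_add_distrib,
    ← Finset.sum_smul, smul_add, smul_smul]

lemma abs_tensor_le {T : ι → ι → ℝ} (hT : ∀ a b, |T a b| ≤ 1) (v w : ι → ℝ) {A C : ℝ}
    (hv : ∑ a, |v a| ≤ A) (hw : ∑ a, |w a| ≤ C) :
    |∑ a, ∑ b, T a b * (v a * w b)| ≤ A * C := by
  calc |∑ a, ∑ b, T a b * (v a * w b)| ≤ ∑ a, ∑ b, |v a| * |w b| := by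
        refine (Finset.abs_sum_le_sum_abs _ _).trans (Finset.sum_le_sum fun a _ => ?_)
        refine (Finset.abs_sum_le_sum_abs _ _).trans (Finset.sum_le_sum fun b _ => ?_)
        rw [abs_mul, abs_mul]
        exact mul_le_of_le_one_left (by positivity) (hT a b)
    _ = (∑ a, |v a|) * ∑ b, |w b| := (Finset.sum_mul_sum _ _ _ _).symm
    _ ≤ A * C := by
        have h : 0 ≤ ∑ a, |v a| := Finset.sum_nonneg fun a _ => abs_nonneg _
        have h' : 0 ≤ ∑ a, |w a| := Finset.sum_nonneg fun a _ => abs_nonneg _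
        exact mul_le_mul hv hw h' (h.trans hv)

/-- Combinations of products of functions with geometrically growing derivatives are smooth
graphons. -/
theorem tensorFamily_mem_smoothGraphons {γ L p lam B : ℝ} {T : ι → ι → ℝ} {u : ι → ℕ → ℝ → ℝ}
    (hγ : 0 ≤ γ) (hlam : 0 ≤ lam) (hB : 1 ≤ B) (hlp : lam ≤ p) (hp : p + lam ≤ 1)
    (hL : p + 3 * (lam * B ^ γ) ≤ L)
    (hT : ∀ a b, |T a b| ≤ 1) (hTs : ∀ a b, T a b = T b a)
    (hu : ∀ a j x, HasDerivAt (u a j) (u a (j + 1) x) x)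
    (hbd : ∀ j x, ∑ a, |u a j x| ≤ B ^ j) :
    tensorFamily p lam T u 0 0 ∈ smoothGraphons γ L := by
  have hg := isDerivFamily_tensorFamily p lam T hu
  have hten : ∀ j k (z : ℝ × ℝ), |lam * ∑ a, ∑ b, T a b * (u a j z.1 * u b k z.2)| ≤
      lam * B ^ (j + k) := by
    intro j k z
    rw [abs_mul, abs_of_nonneg hlam, pow_add]
    exact mul_le_mul_of_nonneg_left (abs_tensor_le hT _ _ (hbd j z.1) (hbd k z.2)) hlam
  have h0 : ∀ z, |tensorFamily p lam T u 0 0 z - p| ≤ lam := by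
    intro z
    have := hten 0 0 z
    simpa [tensorFamily] using this
  refine ⟨⟨(hg.contDiff _ 0 0).contDiffOn, ?_, ?_⟩, ?_⟩
  · refine (hg.holderNorm_le hγ hlam hB (hlam.trans hlp) h0 ?_).trans
      (ENNReal.ofReal_le_ofReal hL)
    intro j k z hjk
    have := hten j k z
    rwa [tensorFamily, if_neg hjk.ne', zero_add]
  · intro x _ y _
    simp only [tensorFamily]
    rw [Finset.sum_comm]
    congr 2
    refine Finset.sum_congr rfl fun a _ => Finset.sum_congr rfl fun b _ => ?_
    rw [hTs b a]; ring
  · intro x _ y _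
    have := abs_le.1 (h0 (x, y))
    constructor <;> linarith

end Interpolation

/-! ### Fejér kernels on a grid. -/

/-- The frequency `2πil`. -/
def freq (l : ℕ) : ℂ := 2 * (Real.pi : ℂ) * Complex.I * (l : ℂ)

lemma norm_freq (l : ℕ) : ‖freq l‖ = 2 * Real.pi * l := by
  simp [freq, abs_of_pos Real.pi_pos]

lemma conj_freq (l : ℕ) : (starRingEnd ℂ) (freq l) = -freq l := by
  simp only [freq, map_mul, map_ofNat, Complex.conj_I, Complex.conj_ofReal, map_natCast]
  ring

lemma sum_exp_freq {K : ℕ} (s t : Fin K) :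
    ∑ a : Fin K, Complex.exp (freq a * (((s : ℂ) - (t : ℂ)) / K)) = if s = t then (K : ℂ) else 0 := by
  have hK : (K : ℂ) ≠ 0 := by
    have := s.pos
    exact_mod_cast this.ne'
  split_ifs with hst
  · subst hst; simp
  · set ζ := Complex.exp (2 * (Real.pi : ℂ) * Complex.I * (((s : ℂ) - (t : ℂ)) / K)) with hζ
    have h1 : ∀ a : Fin K, Complex.exp (freq a * (((s : ℂ) - (t : ℂ)) / K)) = ζ ^ (a : ℕ) := by
      intro a
      rw [hζ, ← Complex.exp_nat_mul, freq]
      congr 1; ring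
    simp only [h1]
    rw [Fin.sum_univ_eq_sum_range (fun a => ζ ^ a)]
    have hζK : ζ ^ K = 1 := by
      rw [hζ, ← Complex.exp_nat_mul, Complex.exp_eq_one_iff]
      refine ⟨(s : ℤ) - (t : ℤ), ?_⟩
      push_cast
      field_simp
    have hζ1 : ζ ≠ 1 := by
      intro h
      rw [hζ, Complex.exp_eq_one_iff] at h
      obtain ⟨m, hm⟩ := h
      have hpi : (2 * (Real.pi : ℂ) * Complex.I) ≠ 0 := Complex.two_pi_I_ne_zero
      rw [mul_comm (m : ℂ)] at hm
      have hm := mul_left_cancel₀ hpi hm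
      rw [div_eq_iff hK] at hm
      have hm' : (s : ℤ) - (t : ℤ) = m * K := by exact_mod_cast hm
      have hs := s.2
      have ht := t.2
      have hne : (s : ℤ) ≠ t := by exact_mod_cast fun h => hst (Fin.ext h)
      rcases lt_trichotomy m 0 with h | h | h
      · nlinarith
      · subst h; omega
      · nlinarith
    have := geom_sum_mul ζ K
    rw [hζK, sub_self] at this
    exact (mul_eq_zero.1 this).resolve_right (sub_ne_zero.2 hζ1)

/-- Parseval's identity for trigonometric polynomials sampled on the grid. -/
lemma sum_norm_sq_trig {K : ℕ} (z : Fin K → ℂ) (x : ℝ) :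
    ∑ a : Fin K, ‖∑ l : Fin K, z l * Complex.exp (freq l * ((x : ℂ) - (a : ℂ) / K))‖ ^ 2 =
      K * ∑ l, ‖z l‖ ^ 2 := by
  have hconj : ∀ (l a : Fin K),
      (starRingEnd ℂ) (Complex.exp (freq l * ((x : ℂ) - (a : ℂ) / K))) =
      Complex.exp (-(freq l * ((x : ℂ) - (a : ℂ) / K))) := by
    intro l a
    rw [← Complex.exp_conj, map_mul, conj_freq]
    congr 1
    simp
  have hC : ∑ a : Fin K, (∑ l : Fin K, z l * Complex.exp (freq l * ((x : ℂ) - (a : ℂ) / K))) *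
      (starRingEnd ℂ) (∑ l : Fin K, z l * Complex.exp (freq l * ((x : ℂ) - (a : ℂ) / K))) =
      K * ∑ l, z l * (starRingEnd ℂ) (z l) := by
    simp only [map_sum, map_mul, hconj, Finset.sum_mul_sum]
    rw [Finset.sum_comm]
    rw [Finset.mul_sum]
    refine Finset.sum_congr rfl fun l _ => ?_
    rw [Finset.sum_comm]
    have hterm : ∀ l' : Fin K, ∑ a : Fin K, z l * Complex.exp (freq l * ((x : ℂ) - (a : ℂ) / K)) *
        ((starRingEnd ℂ) (z l') * Complex.exp (-(freq l' * ((x : ℂ) - (a : ℂ) / K)))) =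
        z l * (starRingEnd ℂ) (z l') * Complex.exp ((freq l - freq l') * x) *
          if l' = l then (K : ℂ) else 0 := by
      intro l'
      rw [← sum_exp_freq, Finset.mul_sum]
      refine Finset.sum_congr rfl fun a _ => ?_
      have : Complex.exp (freq l * ((x : ℂ) - (a : ℂ) / K)) *
          Complex.exp (-(freq l' * ((x : ℂ) - (a : ℂ) / K))) =
          Complex.exp ((freq l - freq l') * x) *
            Complex.exp (freq a * (((l' : ℂ) - (l : ℂ)) / K)) := by
        rw [← Complex.exp_add, ← Complex.exp_add]
        congr 1
        simp only [freq]
        ring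
      linear_combination (z l * (starRingEnd ℂ) (z l')) * this
    simp only [hterm, mul_ite, mul_zero, Finset.sum_ite_eq', Finset.mem_univ, if_true, sub_self,
      zero_mul, Complex.exp_zero, mul_one]
    ring
  simp only [Complex.mul_conj, Complex.normSq_eq_norm_sq] at hC
  exact_mod_cast hC

/-- The Fejér kernel centred at the grid point `a / K`, with its derivatives. -/
def fejer (K : ℕ) (a : Fin K) (j : ℕ) (x : ℝ) : ℝ :=
  (((K : ℂ) ^ 2)⁻¹ * ∑ l : Fin K, ∑ l' : Fin K, (freq l - freq l') ^ j *
    Complex.exp ((freq l - freq l') * ((x : ℂ) - (a : ℂ) / K))).re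

lemma hasDerivAt_fejer {K : ℕ} (a : Fin K) (j : ℕ) (x : ℝ) :
    HasDerivAt (fejer K a j) (fejer K a (j + 1) x) x := by
  have hterm : ∀ c : ℂ, HasDerivAt
      (fun y : ℝ => c ^ j * Complex.exp (c * ((y : ℂ) - (a : ℂ) / K)))
      (c ^ (j + 1) * Complex.exp (c * ((x : ℂ) - (a : ℂ) / K))) x := by
    intro c
    have h1 : HasDerivAt (fun y : ℝ => c * ((y : ℂ) - (a : ℂ) / K)) (c * 1) x :=
      ((Complex.ofRealCLM.hasDerivAt (x := x)).sub_const _).const_mul c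
    refine ((h1.cexp).const_mul (c ^ j)).congr_deriv ?_
    ring
  have hsum := (HasDerivAt.fun_sum fun l (_ : l ∈ (Finset.univ : Finset (Fin K))) =>
    HasDerivAt.fun_sum fun l' (_ : l' ∈ (Finset.univ : Finset (Fin K))) =>
      hterm (freq l - freq l')).const_mul (((K : ℂ) ^ 2)⁻¹)
  exact Complex.reCLM.hasFDerivAt.comp_hasDerivAt x hsum

/-- Leibniz rule for the product of the Dirichlet-type sum and its conjugate, written with the
binomial expansion of `(freq l - freq l') ^ j`. -/
lemma sum_pow_sub_mul_exp {K : ℕ} (a : Fin K) (j : ℕ) (x : ℝ) :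
    ∑ l : Fin K, ∑ l' : Fin K, (freq l - freq l') ^ j *
        Complex.exp ((freq l - freq l') * ((x : ℂ) - (a : ℂ) / K)) =
      ∑ i ∈ Finset.range (j + 1), (j.choose i : ℂ) *
        ((∑ l : Fin K, freq l ^ i * Complex.exp (freq l * ((x : ℂ) - (a : ℂ) / K))) *
          (starRingEnd ℂ) (∑ l : Fin K, freq l ^ (j - i) *
            Complex.exp (freq l * ((x : ℂ) - (a : ℂ) / K)))) := by
  have hconj : ∀ (l : Fin K),
      (starRingEnd ℂ) (Complex.exp (freq l * ((x : ℂ) - (a : ℂ) / K))) =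
      Complex.exp (-(freq l * ((x : ℂ) - (a : ℂ) / K))) := by
    intro l
    rw [← Complex.exp_conj, map_mul, conj_freq]
    congr 1
    simp
  simp only [map_sum, map_mul, map_pow, hconj, conj_freq, Finset.sum_mul_sum]
  simp only [Finset.mul_sum]
  conv_rhs => rw [Finset.sum_comm]
  refine Finset.sum_congr rfl fun l _ => ?_
  conv_rhs => rw [Finset.sum_comm]
  refine Finset.sum_congr rfl fun l' _ => ?_
  rw [sub_mul, sub_eq_add_neg, sub_eq_add_neg, Complex.exp_add, add_pow, Finset.sum_mul]
  refine Finset.sum_congr rfl fun i _ => ?_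
  ring

/-- By Leibniz, each derivative is a sum of products of two trigonometric polynomials.
Cauchy–Schwarz over the centres and Parseval bound each product sum, and the binomial theorem turns
`2πK + 2πK` into `4πK`. The case `j = 0` makes the interpolation a contraction in sup norm. -/
lemma sum_abs_fejer_le {K : ℕ} (j : ℕ) (x : ℝ) :
    ∑ a : Fin K, |fejer K a j x| ≤ (4 * Real.pi * K) ^ j := by
  rcases Nat.eq_zero_or_pos K with rfl | hK
  · simp only [Finset.univ_eq_empty, Finset.sum_empty]; positivity
  have hK' : (0 : ℝ) < K := by exact_mod_cast hK
  set P : ℕ → Fin K → ℂ := fun i a =>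
    ∑ l : Fin K, freq l ^ i * Complex.exp (freq l * ((x : ℂ) - (a : ℂ) / K)) with hP
  have hpars : ∀ i, ∑ a, ‖P i a‖ ^ 2 ≤ (K * (2 * Real.pi * K) ^ i) ^ 2 := by
    intro i
    simp only [hP]
    rw [sum_norm_sq_trig (fun l : Fin K => freq l ^ i) x]
    have : ∑ l : Fin K, ‖freq l ^ i‖ ^ 2 ≤ ∑ l : Fin K, ((2 * Real.pi * K) ^ i) ^ 2 := by
      refine Finset.sum_le_sum fun l _ => ?_
      rw [norm_pow, norm_freq]
      have : (l : ℝ) ≤ K := by exact_mod_cast l.2.le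
      have := Real.pi_pos
      gcongr
    rw [Finset.sum_const, Finset.card_univ, Fintype.card_fin, nsmul_eq_mul] at this
    calc (K : ℝ) * ∑ l : Fin K, ‖freq l ^ i‖ ^ 2 ≤ K * (K * ((2 * Real.pi * K) ^ i) ^ 2) := by gcongr
      _ = _ := by ring
  have hcs : ∀ i i', ∑ a, ‖P i a‖ * ‖P i' a‖ ≤
      (K * (2 * Real.pi * K) ^ i) * (K * (2 * Real.pi * K) ^ i') := by
    intro i i'
    have hpi := Real.pi_pos
    refine (Real.sum_mul_le_sqrt_mul_sqrt _ _ _).trans ?_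
    refine mul_le_mul ?_ ?_ (Real.sqrt_nonneg _) (by positivity)
    · exact (Real.sqrt_le_sqrt (hpars i)).trans (Real.sqrt_sq (by positivity)).le
    · exact (Real.sqrt_le_sqrt (hpars i')).trans (Real.sqrt_sq (by positivity)).le
  have hle : ∀ a : Fin K, |fejer K a j x| ≤ ((K : ℝ) ^ 2)⁻¹ *
      ∑ i ∈ Finset.range (j + 1), (j.choose i : ℝ) * (‖P i a‖ * ‖P (j - i) a‖) := by
    intro a
    refine (Complex.abs_re_le_norm _).trans ?_
    rw [sum_pow_sub_mul_exp, norm_mul, norm_inv, norm_pow, Complex.norm_natCast]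
    gcongr
    refine (norm_sum_le _ _).trans (Finset.sum_le_sum fun i _ => ?_)
    rw [norm_mul, norm_mul, RCLike.norm_conj, Complex.norm_natCast]
  refine (Finset.sum_le_sum fun a _ => hle a).trans ?_
  rw [← Finset.mul_sum, Finset.sum_comm]
  simp only [← Finset.mul_sum]
  calc ((K : ℝ) ^ 2)⁻¹ * ∑ i ∈ Finset.range (j + 1), (j.choose i : ℝ) *
        ∑ a, ‖P i a‖ * ‖P (j - i) a‖
      ≤ ((K : ℝ) ^ 2)⁻¹ * ∑ i ∈ Finset.range (j + 1), (j.choose i : ℝ) *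
        ((K * (2 * Real.pi * K) ^ i) * (K * (2 * Real.pi * K) ^ (j - i))) := by
        gcongr with i _
        exact hcs _ _
    _ = ∑ i ∈ Finset.range (j + 1),
          (2 * Real.pi * K) ^ i * (2 * Real.pi * K) ^ (j - i) * (j.choose i : ℝ) := by
        rw [Finset.mul_sum]
        refine Finset.sum_congr rfl fun i _ => ?_
        field_simp
    _ = (4 * Real.pi * K) ^ j := by
        rw [← add_pow]; ring

lemma fejer_apply_grid {K : ℕ} (a b : Fin K) : fejer K a 0 ((b : ℝ) / K) = if a = b then 1 else 0 := by
  have hK : (K : ℂ) ≠ 0 := by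
    have := a.pos
    exact_mod_cast this.ne'
  have h := sum_pow_sub_mul_exp a 0 ((b : ℝ) / K)
  rw [fejer, h]
  simp only [zero_add, Finset.range_one, Finset.sum_singleton, Nat.choose_self, Nat.cast_one,
    one_mul, pow_zero, Nat.sub_self]
  have h1 : ∑ l : Fin K, Complex.exp (freq l * ((((b : ℝ) / K : ℝ) : ℂ) - (a : ℂ) / K)) =
      if b = a then (K : ℂ) else 0 := by
    rw [← sum_exp_freq b a]
    refine Finset.sum_congr rfl fun l _ => ?_
    push_cast
    rw [sub_div]
  rw [h1]
  by_cases hab : a = b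
  · subst hab
    simp only [if_true, Complex.conj_natCast]
    rw [← sq, inv_mul_cancel₀ (pow_ne_zero 2 hK)]; simp
  · rw [if_neg hab, if_neg (Ne.symm hab)]; simp

/-! ### Graphons interpolating the sign table. -/

lemma card_label (d : ℕ) : Fintype.card (Label d) = 2 * 4 ^ d := by
  simp only [Fintype.card_prod, ZMod.card, Fintype.card_fun, Fintype.card_fin]
  rw [← mul_pow]; norm_num

/-- There is a smooth graphon interpolating the sign table on a regular grid. -/
theorem exists_interpolating_graphon (d : ℕ) {γ L p lam : ℝ} (hγ : 0 ≤ γ) (hlam : 0 ≤ lam)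
    (hlp : lam ≤ p) (hp : p + lam ≤ 1)
    (hL : p + 3 * (lam * (4 * Real.pi * (2 * 4 ^ d)) ^ γ) ≤ L) :
    ∃ f ∈ smoothGraphons γ L, Continuous f ∧ ∃ pts : Label d → I,
      ∀ x y, f ((pts x : ℝ), (pts y : ℝ)) = p + lam * table x y := by
  classical
  set K := 2 * 4 ^ d with hKdef
  have hK : 0 < K := by positivity
  have hKr : (0 : ℝ) < K := by exact_mod_cast hK
  have hKc : (2 * 4 ^ d : ℝ) = K := by rw [hKdef]; push_cast; ring
  rw [hKc] at hL
  let e : Label d ≃ Fin K := Fintype.equivFinOfCardEq (card_label d)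
  have hB : 1 ≤ 4 * Real.pi * K := by
    have h1 : (1 : ℝ) ≤ K := by exact_mod_cast hK
    nlinarith [Real.pi_gt_three]
  refine ⟨tensorFamily p lam (fun a b => table (e.symm a) (e.symm b)) (fejer K) 0 0,
    tensorFamily_mem_smoothGraphons hγ hlam hB hlp hp hL (fun a b => (abs_table _ _).le)
      (fun a b => table_comm _ _) hasDerivAt_fejer sum_abs_fejer_le,
    ((isDerivFamily_tensorFamily p lam _ hasDerivAt_fejer).contDiff 0 0 0).continuous,
    fun x => ⟨(e x : ℝ) / K, by positivity, ?_⟩, ?_⟩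
  · rw [div_le_one hKr]
    exact_mod_cast (e x).2.le
  · intro x y
    simp only [tensorFamily, fejer_apply_grid, add_zero, if_true]
    simp

/-- For two labels, a smooth graphon interpolating the sign table whose derivatives are all
small. -/
theorem exists_interpolating_graphon_two {γ L p lam : ℝ} (hγ : 0 ≤ γ) (hlam : 0 ≤ lam)
    (hlp : lam ≤ p) (hp : p + lam ≤ 1) (hL : p + 3 * lam ≤ L) :
    ∃ f ∈ smoothGraphons γ L, Continuous f ∧ ∃ pts : Label 0 → I,
      ∀ x y, f ((pts x : ℝ), (pts y : ℝ)) = p + lam * Real.sin (1 / 2) ^ 2 * table x y := by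
  classical
  -- For `d = 0` the table is a product of two signs. A sine of frequency one takes the values `±
  -- sin (1/2)` at the end points, and all its derivatives are at most one, so no power `B ^ γ` with
  -- `B > 1` appears.
  set u : Unit → ℕ → ℝ → ℝ := fun _ j x => Real.sin (x - 1 / 2 + j * (Real.pi / 2)) with hu
  have hderiv : ∀ a j x, HasDerivAt (u a j) (u a (j + 1) x) x := by
    intro a j x
    have h1 : HasDerivAt (fun x : ℝ => x - 1 / 2 + j * (Real.pi / 2)) 1 x :=
      ((hasDerivAt_id x).sub_const _).add_const _
    refine h1.sin.congr_deriv ?_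
    simp only [hu]
    push_cast
    rw [mul_one, ← Real.sin_add_pi_div_two]
    congr 1; ring
  have hbd : ∀ j x, ∑ a, |u a j x| ≤ (1 : ℝ) ^ j := by
    intro j x
    simp [hu, Real.abs_sin_le_one]
  refine ⟨tensorFamily p lam (fun _ _ => 1) u 0 0,
    tensorFamily_mem_smoothGraphons hγ hlam le_rfl hlp hp (by simpa using hL) (by simp) (by simp)
      hderiv hbd,
    ((isDerivFamily_tensorFamily p lam _ hderiv).contDiff 0 0 0).continuous,
    fun x => if x.1 = 0 then 1 else 0, ?_⟩
  intro x y
  have hval : ∀ x : Label 0, u () 0 ((if x.1 = 0 then (1 : I) else 0 : I) : ℝ) =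
      sgn x.1 * Real.sin (1 / 2) := by
    intro x
    simp only [hu, sgn]
    split_ifs
    · norm_num
    · have : ((0 : I) : ℝ) - 1 / 2 + ((0 : ℕ) : ℝ) * (Real.pi / 2) = -(1 / 2) := by norm_num
      rw [this, Real.sin_neg]; ring
  have htab : table x y = sgn x.1 * sgn y.1 := by
    rw [table, form, sgn_add, sgn_add]
    simp [sgn_zero]
  simp only [tensorFamily, Finset.univ_unique, Finset.sum_singleton, PUnit.default_eq_unit,
    hval, htab, add_zero, if_true]
  ring

/-- A smooth graphon interpolating the sign table at the critical amplitude gives a lower bound for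
the low degree minimax risk. -/
theorem le_lowDegreeMinimaxRisk {γ L p c lam : ℝ} {n D d : ℕ} (hn : 2 ≤ n) (hD : 1 ≤ D)
    (hp : 0 < p) (hp' : p ≤ 1 / 4) (hc : 0 ≤ c) (hcp : 1024 * c ≤ p ^ 2)
    (hd : ((4 : ℝ) ^ d) ^ 3 ≤ n) (hlam : 0 ≤ lam)
    (hlam2 : lam ^ 2 = c * 4 ^ d / (n * (D : ℝ) ^ 4))
    {f : ℝ × ℝ → ℝ} (hf : f ∈ smoothGraphons γ L) (hcont : Continuous f) (pts : Label d → I)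
    (hpts : ∀ x y, f ((pts x : ℝ), (pts y : ℝ)) = p + lam * table x y) :
    ENNReal.ofReal (lam ^ 2 / 2) ≤ lowDegreeMinimaxRisk γ L n D := by
  refine le_iInf₂ fun Mhat hM => le_iSup₂_of_le f hf (le_iSup_of_le (uniformLaw pts) ?_)
  have hn0 : (0 : ℝ) < n := by exact_mod_cast (by omega : 0 < n)
  have hD1 : (1 : ℝ) ≤ (D : ℝ) ^ 4 := one_le_pow₀ (by exact_mod_cast hD)
  have hQ1 : (1 : ℝ) ≤ 4 ^ d := one_le_pow₀ (by norm_num)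
  have hQn : (4 : ℝ) ^ d ≤ n := (le_self_pow₀ hQ1 (by norm_num)).trans hd
  have hlc : lam ^ 2 ≤ c := by
    rw [hlam2, div_le_iff₀ (by positivity)]
    calc c * 4 ^ d ≤ c * n := by gcongr
      _ ≤ c * (n * (D : ℝ) ^ 4) := by
        gcongr
        exact le_mul_of_one_le_right hn0.le hD1
  have hlp : lam ≤ p / 32 := by
    refine abs_le_of_sq_le_sq' (by nlinarith) (by positivity) |>.2
  have hu : 4 / p * c ≤ p / 256 := by
    rw [div_mul_eq_mul_div, div_le_iff₀ hp]
    nlinarith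
  have hul : 4 / p * lam ^ 2 ≤ 4 / p * c := by gcongr
  -- Since `lam ≤ p / 32` and `p ≤ 1 / 4`, the variance of each edge is at least `p / 4`; hence `u =
  -- 4 / p`.
  refine le_risk (u := 4 / p) (η := 4 / p * c) hn hd ?_ (by positivity) (by linarith)
    (by linarith) (by positivity) ?_ hcont pts hpts Mhat hM
  · rw [hlam2]; ring
  · intro s hs
    have h1 : |lam * s| ≤ p / 32 := by rwa [abs_mul, hs, mul_one, abs_of_nonneg hlam]
    obtain ⟨h2, h3⟩ := abs_le.1 h1
    refine ⟨by linarith, by linarith, ?_⟩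
    rw [div_le_div_iff₀ (mul_pos (by linarith) (by linarith)) hp]
    nlinarith

end Graphon

end

/-! ### Choice of the parameters. -/

theorem theorem3 (L : ℝ) (hL : 0 < L) :
    ∃ c : ℝ, 0 < c ∧ ∀ γ : ℝ, 3 / 2 ≤ γ → ∀ n D : ℕ, 2 ≤ n → 1 ≤ D →
      ENNReal.ofReal (c * (n : ℝ) ^ (-(2 * γ / (2 * γ + 1))) / (D : ℝ) ^ 4) ≤
        Graphon.lowDegreeMinimaxRisk γ L n D := by
  set p : ℝ := min L 1 / 4 with hp
  have hp0 : 0 < p := by have := lt_min hL one_pos; positivity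
  have hp1 : p ≤ 1 / 4 := by have := min_le_right L 1; rw [hp]; linarith
  have hpL : p ≤ L / 4 := by have := min_le_left L 1; rw [hp]; linarith
  set s : ℝ := Real.sin (1 / 2) ^ 2 with hs
  have hsin : 0 < Real.sin (1 / 2) :=
    Real.sin_pos_of_pos_of_lt_pi (by norm_num) (by linarith [Real.pi_gt_three])
  have hs0 : 0 < s := by positivity
  have hs1 : s ≤ 1 := Real.sin_sq_le_one _
  set κ : ℝ := (p * s / 32) ^ 2 with hκ
  have hκ0 : 0 < κ := by positivity
  have hκp : 1024 * κ ≤ p ^ 2 := by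
    have : 1024 * κ = p ^ 2 * s ^ 2 := by rw [hκ]; ring
    rw [this]
    exact mul_le_of_le_one_right (sq_nonneg _) (pow_le_one₀ hs0.le hs1)
  have hpi := Real.pi_gt_three
  refine ⟨κ / (64 * Real.pi), by positivity, fun γ hγ n D hn hD => ?_⟩
  have hn0 : (0 : ℝ) < n := by exact_mod_cast (by omega : 0 < n)
  have hn1 : (1 : ℝ) ≤ n := by exact_mod_cast (by omega : 1 ≤ n)
  have hD1 : (1 : ℝ) ≤ D := by exact_mod_cast hD
  have hD4 : (1 : ℝ) ≤ (D : ℝ) ^ 4 := one_le_pow₀ hD1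
  have hγ1 : 0 < 2 * γ + 1 := by linarith
  set N : ℝ := (n : ℝ) ^ (1 / (2 * γ + 1)) with hN
  have hN1 : 1 ≤ N := Real.one_le_rpow hn1 (by positivity)
  have hNn : N ^ (2 * γ + 1) = n := by
    rw [hN, ← Real.rpow_mul hn0.le, one_div_mul_cancel hγ1.ne', Real.rpow_one]
  have hrate : (n : ℝ) ^ (-(2 * γ / (2 * γ + 1))) = N / n := by
    rw [hN, ← Real.rpow_sub_one hn0.ne']
    congr 1
    field_simp
    ring
  rw [hrate]
  have hfinal : ∀ d : ℕ, N ≤ 32 * Real.pi * 4 ^ d →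
      κ / (64 * Real.pi) * (N / n) / (D : ℝ) ^ 4 ≤ κ * 4 ^ d / (n * (D : ℝ) ^ 4) / 2 := by
    intro d hd
    calc κ / (64 * Real.pi) * (N / n) / (D : ℝ) ^ 4
        = κ / (64 * Real.pi * n * (D : ℝ) ^ 4) * N := by field_simp
      _ ≤ κ / (64 * Real.pi * n * (D : ℝ) ^ 4) * (32 * Real.pi * 4 ^ d) := by gcongr
      _ = κ * 4 ^ d / (n * (D : ℝ) ^ 4) / 2 := by field_simp; norm_num
  -- `8π` is `4πK` for the smallest grid, `K = 2`. Below it the Fejér interpolant is too rough for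
  -- large `γ`, and the sine graphon is used with amplitude `lam / s`.
  rcases lt_or_ge N (8 * Real.pi) with hcase | hcase
  · set lam : ℝ := Real.sqrt (κ * 4 ^ 0 / (n * (D : ℝ) ^ 4)) with hlam
    have hlam0 : 0 ≤ lam := Real.sqrt_nonneg _
    have hlam2 : lam ^ 2 = κ * 4 ^ 0 / (n * (D : ℝ) ^ 4) := Real.sq_sqrt (by positivity)
    have hlamκ : lam ^ 2 ≤ κ := by
      rw [hlam2, pow_zero, mul_one]
      exact div_le_self hκ0.le (one_le_mul_of_one_le_of_one_le hn1 hD4)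
    have hlamp : lam ≤ p * s / 32 := (abs_le_of_sq_le_sq' hlamκ (by positivity)).2
    have hlams : lam / s ≤ p / 32 := by rw [div_le_iff₀ hs0]; linarith
    obtain ⟨f, hf, hcont, pts, hpts⟩ := Graphon.exists_interpolating_graphon_two
      (γ := γ) (L := L) (p := p) (lam := lam / s) (by linarith) (by positivity) (by linarith)
      (by linarith) (by linarith)
    have hpts' : ∀ x y, f ((pts x : ℝ), (pts y : ℝ)) = p + lam * Graphon.table x y := by
      intro x y
      rw [hpts, ← hs, div_mul_cancel₀ _ hs0.ne']
    refine le_trans (ENNReal.ofReal_le_ofReal ?_) (Graphon.le_lowDegreeMinimaxRisk hn hD hp0 hp1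
      hκ0.le hκp (by simpa using hn1) hlam0 hlam2 hf hcont pts hpts')
    rw [hlam2]
    refine hfinal 0 ?_
    simp only [pow_zero, mul_one]
    linarith
  -- The largest grid with `4πK ≤ N`. Maximality loses at most a factor four, which is the `32π` in
  -- `hfinal`.
  · obtain ⟨d, hd1, hd2⟩ : ∃ d : ℕ, (4 : ℝ) ^ d ≤ N / (8 * Real.pi) ∧
        N / (8 * Real.pi) < 4 ^ (d + 1) :=
      exists_nat_pow_near ((one_le_div (by positivity)).2 hcase) (by norm_num)
    rw [le_div_iff₀ (by positivity)] at hd1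
    rw [div_lt_iff₀ (by positivity)] at hd2
    set Q : ℝ := 4 ^ d with hQ
    have hQ1 : 1 ≤ Q := one_le_pow₀ (by norm_num)
    set R : ℝ := 4 * Real.pi * (2 * Q) with hR
    have hRN : R ≤ N := by rw [hR]; linarith
    have hQR : Q ≤ R := by rw [hR]; nlinarith
    have hR1 : 1 ≤ R := hQ1.trans hQR
    have hR0 : 0 < R := by linarith
    have hRn : R ^ (2 * γ + 1) ≤ n := by
      rw [← hNn]; exact Real.rpow_le_rpow hR0.le hRN hγ1.le
    -- The size condition of the cumulant bound, available because `2γ + 1 ≥ 3`.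
    have hQ3 : Q ^ 3 ≤ n := by
      calc Q ^ 3 ≤ R ^ 3 := by gcongr
        _ = R ^ (3 : ℝ) := by rw [← Real.rpow_natCast]; norm_num
        _ ≤ R ^ (2 * γ + 1) := Real.rpow_le_rpow_of_exponent_le hR1 (by linarith)
        _ ≤ n := hRn
    set lam : ℝ := Real.sqrt (κ * Q / (n * (D : ℝ) ^ 4)) with hlam
    have hlam0 : 0 ≤ lam := Real.sqrt_nonneg _
    have hlam2 : lam ^ 2 = κ * Q / (n * (D : ℝ) ^ 4) := Real.sq_sqrt (by positivity)
    have hRγ : 1 ≤ R ^ γ := Real.one_le_rpow hR1 (by linarith)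
    -- The bias–variance balance: `lam² R^(2γ)` is at most `κ R^(2γ+1) / n ≤ κ`.
    have hamp : lam * R ^ γ ≤ p * s / 32 := by
      refine (abs_le_of_sq_le_sq' ?_ (by positivity)).2
      rw [← hκ, mul_pow, hlam2, div_mul_eq_mul_div, div_le_iff₀ (by positivity), mul_assoc]
      refine mul_le_mul_of_nonneg_left ?_ hκ0.le
      calc Q * (R ^ γ) ^ 2 ≤ R * (R ^ γ) ^ 2 := by gcongr
        _ = R ^ (2 * γ + 1) := by
          rw [Real.rpow_add hR0, Real.rpow_one, two_mul, Real.rpow_add hR0]; ring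
        _ ≤ n := hRn
        _ ≤ n * (D : ℝ) ^ 4 := le_mul_of_one_le_right hn0.le hD4
    have hps : p * s ≤ p := mul_le_of_le_one_right hp0.le hs1
    have hlamp : lam ≤ p / 32 := by
      have : lam ≤ lam * R ^ γ := le_mul_of_one_le_right hlam0 hRγ
      linarith
    obtain ⟨f, hf, hcont, pts, hpts⟩ := Graphon.exists_interpolating_graphon d
      (γ := γ) (L := L) (p := p) (lam := lam) (by linarith) hlam0 (by linarith)
      (by linarith) (by linarith)
    refine le_trans (ENNReal.ofReal_le_ofReal ?_) (Graphon.le_lowDegreeMinimaxRisk hn hD hp0 hp1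
      hκ0.le hκp hQ3 hlam0 hlam2 hf hcont pts hpts)
    rw [hlam2]
    refine hfinal d ?_
    rw [pow_succ, ← hQ] at hd2
    linarith
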